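/- **The Generalized Zeilberger–Bressoud $q$-Dyson Theorem.** Let $q$ be an indeterminate and put $(y)_k=\prod_{t=0}^{k-1}(1-q^ty)$ for $k\ge 0$ and $(y)_{-k}=\prod_{t=1}^{k}(1-q^{-t}y)^{-1}$ for $k>0$. Fix $n\ge 1$ and an integer vector $\delta=(\delta_1,\dots,\delta_n)$ with $\delta_1+\dots+\delta_n=0$. For non-negative integers $a=(a_1,\dots,a_n)$ let $\sigma=a_1+\dots+a_n$ and let $$D_a(x)=\prod_{1\le i<j\le n}(x_i/x_j)_{a_i}\,(q\,x_j/x_i)_{a_j}$$ be the $q$-Dyson product, a Laurent polynomial in $x_1,\dots,x_n$ over $\mathbb Q(q)$. Let $\mathcal F_\delta$ be the finite set of pairs $(\pi,m)$ with $\pi\in S_n$, $m=(m_1,\dots,m_n)$ a vector of non-negative integers, and $\mathrm{des}(\pi)+m_1+\dots+m_n\le\delta_{\pi(n)}$, where $\mathrm{des}(\pi)$ is the number of $r<n$ with $\pi(r)>\pi(r+1)$. For $(\pi,m)\in\mathcal F_\delta$ put $M_r=m_1+\dots+m_r+\#\{t<r:\pi(t)>\pi(t+1)\}$ and $c_{rs}=M_s-M_r-[\pi(r)>\pi(s)]$,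 where $[P]$ is $1$ if $P$ holds and $0$ otherwise. For a set $I$ of positions write $z_{\pi(I)}=\prod_{t\in I}z_{\pi(t)}$. Define the explicit rational function $R_\delta\in\mathbb Q(q,z_1,\dots,z_n)$ by $$R_\delta(q,z)=\sum_{(\pi,m)\in\mathcal F_\delta}\ \prod_{r=1}^n(-1)^{M_r}q^{\binom{M_r+1}{2}-M_r\delta_{\pi(r)}}z_{\pi(r)}^{e_r}\cdot\frac{\displaystyle\prod_{1\le r<s\le n}\frac{(q\,z_{\pi(\{r,\dots,s\})})_{c_{rs}}}{(q\,z_{\pi(\{r+1,\dots,s-1\})})_{c_{rs}}}}{\displaystyle\prod_{r=1}^n(q\,z_{\pi(\{1,\dots,r-1\})})_{M_r}\,(q\,z_{\pi(\{r+1,\dots,n\})})_{\delta_{\pi(r)}-M_r}},$$ where $e_r=\sum_{s>r}\bigl(M_r+[\pi(r)>\pi(s)]-\delta_{\pi(s)}\bigr)$. Then the following hold. 1. There are a polynomial $N\in\mathbb Q[q,z_1,\dots,z_n]$ and finitely many affine-linear forms $L=c+b_1a_1+\dots+b_na_n$ with non-negative integer coefficients and constant term $c\ge1$ (depending only on $\delta$;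 repetitions allowed) such that $$R_\delta=\frac{N}{\prod_L\bigl(1-q^{c}z_1^{b_1}\cdots z_n^{b_n}\bigr)}.$$ So the denominator of $R_\delta(q,q^{a_1},\dots,q^{a_n})$ is a product of factors $1-q^L$. It is non-zero for all $a$, and for all non-negative integers $a_1,\dots,a_n$ the coefficient of $\prod_i x_i^{\delta_i}$ in $D_a(x)$ equals $$R_\delta(q,q^{a_1},\dots,q^{a_n})\cdot\frac{(q)_{a_1+\dots+a_n}}{(q)_{a_1}\cdots(q)_{a_n}}.$$ 2. For all non-negative integers $a_1,\dots,a_n$, attach to $(\pi,m)\in\mathcal F_\delta$ the lattice point $\alpha$ given by $\alpha_{\pi(r)}=M_r+\sum_{t<r}a_{\pi(t)}$. Distinct pairs give distinct points. For an integer vector $\alpha$ with $0\le\alpha_i\le\sigma-a_i+\delta_i$ for all $i$, the value of $D_a$ at $x_i=q^{\alpha_i}$ is non-zero if and only if $\alpha$ is the point of some $(\pi,m)\in\mathcal F_\delta$. If moreover $a_i\ge\sum_j|\delta_j|$ for all $i$, then the points of all pairs in $\mathcal F_\delta$ satisfy $0\le\alpha_i\le\sigma-a_i+\delta_i$. -/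

import Mathlib

namespace QDyson

/-! ### `q`-Pochhammer symbols, the `q`-Dyson product, the `q`-multinomial coefficient -/

/-- `(y)_k = ∏_{t=0}^{k-1} (1 - q^t y)`. -/
def qPoch {A : Type*} [CommRing A] (q y : A) (k : ℕ) : A :=
  ∏ t ∈ Finset.range k, (1 - q ^ t * y)

/-- The symbol `(y)_c` for an integer `c`: for `c = -k < 0` it is
`1 / ∏_{t=1}^{k} (1 - q^{-t} y)`. -/
def qPochInt {F : Type*} [Field F] (q y : F) (c : ℤ) : F :=
  if 0 ≤ c then qPoch q y c.toNat
  else (∏ t ∈ Finset.Icc 1 (-c).toNat, (1 - (q ^ t)⁻¹ * y))⁻¹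

/-- `∏_{i<j} (x_i/x_j)_{a_i} (q x_j/x_i)_{a_j}`, where `ratio i j` stands for `x_i/x_j`. -/
def qDysonProd {n : ℕ} {A : Type*} [CommRing A] (q : A) (ratio : Fin n → Fin n → A)
    (a : Fin n → ℕ) : A :=
  ∏ i, ∏ j ∈ Finset.Ioi i, qPoch q (ratio i j) (a i) * qPoch q (q * ratio j i) (a j)

/-- The field `ℚ(q)`; the indeterminate `q` is `RatFunc.X`. -/
abbrev K : Type := RatFunc ℚ

/-- Laurent polynomials in `x_1, …, x_n` over `ℚ(q)`; the monomial `x^e` is `single e 1`. -/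
abbrev Laurent (n : ℕ) : Type := AddMonoidAlgebra K (Fin n → ℤ)

/-- The Laurent monomial `x_i / x_j`. -/
noncomputable def xRatio {n : ℕ} (i j : Fin n) : Laurent n :=
  AddMonoidAlgebra.single (Pi.single i 1 - Pi.single j 1) 1

/-- The `q`-Dyson product as a Laurent polynomial in `x_1, …, x_n` over `ℚ(q)`. -/
noncomputable def qDyson {n : ℕ} (a : Fin n → ℕ) : Laurent n :=
  qDysonProd (algebraMap K (Laurent n) RatFunc.X) xRatio a

/-- The value in `ℚ(q)` of the `q`-Dyson product at `x_i = q^{α_i}`. -/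
noncomputable def qDysonAt {n : ℕ} (a : Fin n → ℕ) (α : Fin n → ℤ) : K :=
  qDysonProd RatFunc.X (fun i j => RatFunc.X ^ (α i - α j)) a

/-- `(q)_{a_1+⋯+a_n} / ((q)_{a_1} ⋯ (q)_{a_n})`. -/
noncomputable def qMultinomial {n : ℕ} (a : Fin n → ℕ) : K :=
  qPoch RatFunc.X RatFunc.X (∑ i, a i) / ∏ i, qPoch RatFunc.X RatFunc.X (a i)

/-! ### The finite index set of pairs `(π, m)`

Positions are numbered `0, …, n-1`. -/

/-- The positions `t` at which `π` has a descent, `π (t+1) < π t`. -/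
def descents {n : ℕ} (π : Equiv.Perm (Fin n)) : Finset (Fin n) :=
  {t | ∃ h : t.val + 1 < n, π ⟨t.val + 1, h⟩ < π t}

/-- `des π`, the number of descents. -/
def des {n : ℕ} (π : Equiv.Perm (Fin n)) : ℕ := (descents π).card

/-- `M_r = m_0 + ⋯ + m_r + #{t < r : π (t+1) < π t}`. -/
def partialSum {n : ℕ} (π : Equiv.Perm (Fin n)) (m : Fin n → ℕ) (r : Fin n) : ℕ :=
  ∑ t ∈ Finset.Iic r, m t + (Finset.filter (· < r) (descents π)).card

/-- `des π + ∑ m ≤ δ_{π(last)}` (no condition if there are no variables). -/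
def Feasible {n : ℕ} (δ : Fin n → ℤ) (π : Equiv.Perm (Fin n)) (m : Fin n → ℕ) : Prop :=
  ∀ l : Fin n, l.val + 1 = n → (des π : ℤ) + ∑ t, (m t : ℤ) ≤ δ (π l)

open Classical in
/-- The finite set of all feasible pairs `(π, m)`; see `mem_feasiblePairs`. -/
noncomputable def feasiblePairs {n : ℕ} (δ : Fin n → ℤ) :
    Finset (Equiv.Perm (Fin n) × (Fin n → ℕ)) :=
  (Finset.univ ×ˢ Fintype.piFinset fun _ => Finset.range ((∑ i, (δ i).natAbs) + 1)).filter
    fun p => Feasible δ p.1 p.2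

theorem mem_feasiblePairs {n : ℕ} (δ : Fin n → ℤ) (p : Equiv.Perm (Fin n) × (Fin n → ℕ)) :
    p ∈ feasiblePairs δ ↔ Feasible δ p.1 p.2 := by
  simp only [feasiblePairs, Finset.mem_filter, Finset.mem_product, Finset.mem_univ, true_and,
    Fintype.mem_piFinset, Finset.mem_range, and_iff_right_iff_imp]
  intro h i
  have hn : 0 < n := i.pos
  have h1 := h ⟨n - 1, by omega⟩ (by simp; omega)
  have h2 : p.2 i ≤ ∑ t, p.2 t := Finset.single_le_sum (fun _ _ => Nat.zero_le _) (Finset.mem_univ i)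
  have h3 : (δ (p.1 ⟨n - 1, by omega⟩)).natAbs ≤ ∑ i, (δ i).natAbs :=
    Finset.single_le_sum (f := fun i => (δ i).natAbs) (fun _ _ => Nat.zero_le _) (Finset.mem_univ _)
  zify at h2 h3 ⊢
  have h4 := le_abs_self (δ (p.1 ⟨n - 1, by omega⟩))
  linarith [Int.natCast_nonneg (des p.1)]

/-- The lattice point of `(π, m)`: `α_{π(r)} = M_r + ∑_{t<r} a_{π(t)}`. -/
def latticePoint {n : ℕ} (a : Fin n → ℕ) (p : Equiv.Perm (Fin n) × (Fin n → ℕ)) (i : Fin n) : ℤ :=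
  partialSum p.1 p.2 (p.1.symm i) + ∑ t ∈ Finset.Iio (p.1.symm i), (a (p.1 t) : ℤ)

/-- `0 ≤ α_i ≤ σ - a_i + δ_i` for all `i`, where `σ = a_1 + ⋯ + a_n`. -/
def InGrid {n : ℕ} (δ : Fin n → ℤ) (a : Fin n → ℕ) (α : Fin n → ℤ) : Prop :=
  ∀ i, 0 ≤ α i ∧ α i ≤ (∑ j, (a j : ℤ)) - a i + δ i

/-! ### Rational functions in `q, z_1, …, z_n`, where `z_i` stands for `q^{a_i}` -/

/-- `ℚ[q, z_1, …, z_n]`: the variable `none` is `q`, the variable `some i` is `z_i`. -/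
abbrev Poly (n : ℕ) : Type := MvPolynomial (Option (Fin n)) ℚ

/-- The field `ℚ(q, z_1, …, z_n)`. -/
abbrev Rat (n : ℕ) : Type := FractionRing (Poly n)

/-- The element `q` of `ℚ(q, z_1, …, z_n)`. -/
noncomputable def qGen (n : ℕ) : Rat n := algebraMap (Poly n) (Rat n) (MvPolynomial.X none)

/-- The element `z_i` of `ℚ(q, z_1, …, z_n)`. -/
noncomputable def zGen {n : ℕ} (i : Fin n) : Rat n :=
  algebraMap (Poly n) (Rat n) (MvPolynomial.X (some i))

/-- The substitution `z_i = q^{a_i}`. -/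
noncomputable def evalAt {n : ℕ} (a : Fin n → ℕ) : Poly n →ₐ[ℚ] K :=
  MvPolynomial.aeval fun o => o.elim RatFunc.X fun i => RatFunc.X ^ a i

/-- An affine-linear form `L = c + ∑ b_i a_i` in `a_1, …, a_n`. -/
structure AffineForm (n : ℕ) where
  /-- the constant term -/
  const : ℕ
  /-- the coefficients of `a_1, …, a_n` -/
  coeff : Fin n → ℕ

/-- The polynomial `1 - q^c ∏ z_i^{b_i}`, that is, `1 - q^L`. -/
noncomputable def oneSubQPow {n : ℕ} (L : AffineForm n) : Poly n :=
  1 - MvPolynomial.X none ^ L.const * ∏ i, MvPolynomial.X (some i) ^ L.coeff i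

/-- `(q ∏_{t ∈ I} z_{π(t)})_c`, for a set `I` of positions. -/
noncomputable def block {n : ℕ} (π : Equiv.Perm (Fin n)) (I : Finset (Fin n)) (c : ℤ) : Rat n :=
  qPochInt (qGen n) (qGen n * ∏ t ∈ I, zGen (π t)) c

/-- `c_{rs} = M_s - M_r - [π r > π s]`. -/
def gap {n : ℕ} (π : Equiv.Perm (Fin n)) (m : Fin n → ℕ) (r s : Fin n) : ℤ :=
  (partialSum π m s : ℤ) - partialSum π m r - if π s < π r then 1 else 0

/-- The exponent of `z_{π(t)}` in the monomial factor of the term of `(π, m)`: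
`(number of s > t) * M_t + #{s > t : π t > π s} - ∑_{s > t} δ_{π(s)}`. -/
def zExponent {n : ℕ} (δ : Fin n → ℤ) (π : Equiv.Perm (Fin n)) (m : Fin n → ℕ) (t : Fin n) : ℤ :=
  ∑ s ∈ Finset.Ioi t, ((partialSum π m t : ℤ) + (if π s < π t then 1 else 0) - δ (π s))

/-- The contribution of `(π, m)`: a sign, times a monomial in `q, z_1, …, z_n`, times a quotient
of products of factors `1 - q^k ∏_{i ∈ I} z_i`. -/
noncomputable def summand {n : ℕ} (δ : Fin n → ℤ) (π : Equiv.Perm (Fin n)) (m : Fin n → ℕ) : Rat n :=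
  (∏ r, (-1) ^ partialSum π m r *
      qGen n ^ (((partialSum π m r + 1).choose 2 : ℤ) - partialSum π m r * δ (π r)) *
      zGen (π r) ^ zExponent δ π m r) *
    (∏ r, ∏ s ∈ Finset.Ioi r,
      block π (Finset.Icc r s) (gap π m r s) / block π (Finset.Ioo r s) (gap π m r s)) /
    ∏ r, (block π (Finset.Iio r) (partialSum π m r) *
      block π (Finset.Ioi r) (δ (π r) - partialSum π m r))

/-- The rational function `R_δ ∈ ℚ(q, z_1, …, z_n)`. -/
noncomputable def R {n : ℕ} (δ : Fin n → ℤ) : Rat n :=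
  ∑ p ∈ feasiblePairs δ, summand δ p.1 p.2

end QDyson

namespace QDyson

open Finset

variable {n : ℕ}

/-! The constant-degree argument is the quantitative Combinatorial Nullstellensatz. With `w_i = σ -
a_i`, the product `x^w D_a` is a polynomial, homogeneous of degree `∑ w_i = ∑ (w_i + δ_i)`
(`suppBound_qDyson`). Lagrange interpolation in each variable at the nodes `1, q, …, q^{w_i+δ_i}`
therefore writes the coefficient of `x^δ` in `D_a` as a weighted sum of the values of `D_a` on a
grid (`SuppBound.coeff_eq_sum`).

Most of these values vanish. A non-zero value forces the exponents `α_i` to be spaced apart; sorting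
them, with ties broken by index, gives `π`, and the excess of each gap over its minimal size gives
`m` (`exists_latticePoint_eq`). The upper grid bound at the last position is exactly feasibility. At
a surviving point all factors are quotients of `(q)_k`, and a telescoping product over intervals of
positions extracts the `q`-multinomial coefficient, leaving the summand of `(π, m)`
(`interpolation_term`). A feasible pair whose point falls outside the grid has a summand that
evaluates to zero, so the index set does not depend on `a` (`coeff_qDyson_eq_sum_summandAt`).

It remains to clear denominators. Term by term, `R_δ = P / (μ ∏ (1 - q^L))` with `μ` a monomial, and
evaluation at `z_i = q^{a_i}` is compatible with this form (`HasValue`). To see that `μ` divides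
`P`, use `(y)_a = (y)_∞ / (q^a y)_∞`: replacing `q^a` by `z` shows that the coefficients of `x^δ`
and `x^0` are values of power series `Z`, `Z₀` in `ℚ⟦q, z⟧`. A power series is determined by its
values at positive `a` (`eq_zero_of_evalSeries_eq_zero`), so `P Z₀ = Z μ ∏ (1 - q^L)`. By the case
`δ = 0`, the `q`-Dyson theorem itself, `Z₀` has constant term `1`; it is a unit and `μ` divides `P`
(`monomial_dvd_of_evalAt`). -/

/-! ### Partial sums and the lattice point of a pair -/

theorem partialSum_zero (π : Equiv.Perm (Fin n)) (m : Fin n → ℕ) (h : 0 < n) :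
    partialSum π m ⟨0, h⟩ = m ⟨0, h⟩ := by
  have h1 : Finset.Iic (⟨0, h⟩ : Fin n) = {⟨0, h⟩} := by
    ext t; simp [Fin.le_def, Fin.ext_iff]
  have h2 : Finset.filter (· < (⟨0, h⟩ : Fin n)) (descents π) = ∅ := by
    ext t; simp [Fin.lt_def]
  simp [partialSum, h1, h2]

theorem partialSum_succ (π : Equiv.Perm (Fin n)) (m : Fin n → ℕ) (r : ℕ) (h : r + 1 < n) :
    partialSum π m ⟨r + 1, h⟩ = partialSum π m ⟨r, by omega⟩ + m ⟨r + 1, h⟩ +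
      if π ⟨r + 1, h⟩ < π ⟨r, by omega⟩ then 1 else 0 := by
  have h1 : Finset.Iic (⟨r + 1, h⟩ : Fin n) = insert ⟨r + 1, h⟩ (Finset.Iic ⟨r, by omega⟩) := by
    ext t; simp [Fin.le_def, Fin.ext_iff]; omega
  have h2 : Finset.filter (· < (⟨r + 1, h⟩ : Fin n)) (descents π) =
      (if π ⟨r + 1, h⟩ < π ⟨r, by omega⟩ then {⟨r, by omega⟩} else ∅) ∪
        Finset.filter (· < (⟨r, by omega⟩ : Fin n)) (descents π) := by
    ext t
    simp only [Finset.mem_filter, Finset.mem_union, descents, Finset.mem_univ, true_and]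
    split_ifs with hd
    · simp only [Finset.mem_singleton]
      constructor
      · rintro ⟨ht, hl⟩
        by_cases e : t = ⟨r, by omega⟩
        · exact Or.inl e
        · right
          refine ⟨ht, ?_⟩
          simp only [Fin.lt_def, Fin.ext_iff] at hl e ⊢; omega
      · rintro (rfl | ⟨ht, hl⟩)
        · exact ⟨⟨h, hd⟩, by simp [Fin.lt_def]⟩
        · exact ⟨ht, by simp only [Fin.lt_def] at hl ⊢; omega⟩
    · simp only [Finset.notMem_empty, false_or]
      constructor
      · rintro ⟨ht, hl⟩
        refine ⟨ht, ?_⟩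
        by_cases e : t = ⟨r, by omega⟩
        · obtain ⟨_, h'⟩ := ht
          simp only [e] at h'
          exact absurd h' hd
        · simp only [Fin.lt_def, Fin.ext_iff] at hl e ⊢; omega
      · rintro ⟨ht, hl⟩
        exact ⟨ht, by simp only [Fin.lt_def] at hl ⊢; omega⟩
  have h3 : Disjoint (if π ⟨r + 1, h⟩ < π ⟨r, by omega⟩ then {⟨r, by omega⟩} else ∅)
      (Finset.filter (· < (⟨r, by omega⟩ : Fin n)) (descents π)) := by
    split_ifs <;> simp
  rw [partialSum, partialSum, h1, h2, Finset.card_union_of_disjoint h3, Finset.sum_insert]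
  · split_ifs <;> simp <;> ring
  · simp [Fin.le_def]

theorem partialSum_last (π : Equiv.Perm (Fin n)) (m : Fin n → ℕ) (l : Fin n) (hl : l.val + 1 = n) :
    partialSum π m l = des π + ∑ t, m t := by
  have h1 : Finset.Iic l = Finset.univ := by
    ext t; simp only [Finset.mem_Iic, Fin.le_def, Finset.mem_univ, iff_true]; omega
  have h2 : Finset.filter (· < l) (descents π) = descents π := by
    rw [Finset.filter_eq_self]
    intro t ht
    simp only [descents, Finset.mem_filter, Finset.mem_univ, true_and] at ht
    obtain ⟨h, -⟩ := ht
    simp only [Fin.lt_def]; omega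
  rw [partialSum, h1, h2, des, add_comm]

/-- A sequence of values of `π` that ends below its start must descend somewhere in between, and
each descent adds one to the partial sum. -/
theorem partialSum_add_le (π : Equiv.Perm (Fin n)) (m : Fin n → ℕ) {r s : Fin n} (h : r < s) :
    partialSum π m r + (if π s < π r then 1 else 0) ≤ partialSum π m s := by
  suffices H : ∀ k (hk : r.val + k < n),
      partialSum π m r + (if π ⟨r.val + k, hk⟩ < π r then 1 else 0) ≤
        partialSum π m ⟨r.val + k, hk⟩ by
    have h' := H (s.val - r.val) (by have := Fin.lt_def.1 h; omega)
    have e : (⟨r.val + (s.val - r.val), by have := Fin.lt_def.1 h; omega⟩ : Fin n) = s := by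
      ext; have := Fin.lt_def.1 h; simp; omega
    rwa [e] at h'
  intro k
  induction k with
  | zero => intro hk; simp
  | succ k ih =>
    intro hk
    have h1 := ih (by omega)
    have h2 := partialSum_succ π m (r.val + k) hk
    simp only [← add_assoc] at h2 ⊢
    rw [h2]
    by_cases c1 : π ⟨r.val + k + 1, hk⟩ < π r
    · by_cases c2 : π ⟨r.val + k, by omega⟩ < π r
      · simp only [c1, c2, if_true] at h1 ⊢; omega
      · have c3 : π ⟨r.val + k + 1, hk⟩ < π ⟨r.val + k, by omega⟩ :=
          lt_of_lt_of_le c1 (not_lt.1 c2)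
        simp only [c1, c3, if_true] at h1 ⊢; omega
    · simp only [c1, if_false]; omega

theorem partialSum_mono (π : Equiv.Perm (Fin n)) (m : Fin n → ℕ) {r s : Fin n} (h : r ≤ s) :
    partialSum π m r ≤ partialSum π m s := by
  rcases h.eq_or_lt with rfl | h
  · exact le_rfl
  · exact le_trans (Nat.le_add_right _ _) (partialSum_add_le π m h)

theorem partialSum_injective (π : Equiv.Perm (Fin n)) (m m' : Fin n → ℕ)
    (h : ∀ r, partialSum π m r = partialSum π m' r) : m = m' := by
  funext ⟨r, hr⟩
  cases r with
  | zero => have := h ⟨0, hr⟩; rwa [partialSum_zero, partialSum_zero] at this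
  | succ r =>
    have h1 := h ⟨r + 1, hr⟩
    have h2 := h ⟨r, by omega⟩
    rw [partialSum_succ, partialSum_succ] at h1
    omega

theorem latticePoint_apply (a : Fin n → ℕ) (p : Equiv.Perm (Fin n) × (Fin n → ℕ)) (s : Fin n) :
    latticePoint a p (p.1 s) =
      partialSum p.1 p.2 s + ∑ t ∈ Finset.Iio s, (a (p.1 t) : ℤ) := by
  simp [latticePoint]

theorem latticePoint_add_le (a : Fin n → ℕ) (p : Equiv.Perm (Fin n) × (Fin n → ℕ)) {r s : Fin n}
    (h : r < s) :
    latticePoint a p (p.1 r) + a (p.1 r) + (if p.1 s < p.1 r then 1 else 0) ≤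
      latticePoint a p (p.1 s) := by
  rw [latticePoint_apply, latticePoint_apply]
  have h1 := partialSum_add_le p.1 p.2 h
  have h2 : (∑ t ∈ Finset.Iio r, (a (p.1 t) : ℤ)) + a (p.1 r) ≤
      ∑ t ∈ Finset.Iio s, (a (p.1 t) : ℤ) := by
    rw [add_comm, ← Finset.sum_insert (f := fun t => (a (p.1 t) : ℤ)) (by simp)]
    refine Finset.sum_le_sum_of_subset_of_nonneg ?_ (fun _ _ _ => by positivity)
    intro t ht
    simp only [Finset.mem_insert, Finset.mem_Iio] at ht ⊢
    rcases ht with rfl | ht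
    · exact h
    · exact ht.trans h
  zify at h1
  linarith

/-- The key by which the permutation of a pair sorts the coordinates of its lattice point. -/
def sortKey (α : Fin n → ℤ) (i : Fin n) : ℤ ×ₗ Fin n := toLex (α i, i)

theorem sortKey_injective (α : Fin n → ℤ) : Function.Injective (sortKey α) := by
  intro i j h
  exact congrArg (fun x => (ofLex x).2) h

/-- Equal coordinates can occur only without an inversion, so `π` is the unique permutation that
sorts the coordinates with ties broken by index. This makes `π`, and then `m`, recoverable from the
point. -/
theorem strictMono_sortKey_latticePoint (a : Fin n → ℕ)
    (p : Equiv.Perm (Fin n) × (Fin n → ℕ)) :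
    StrictMono (sortKey (latticePoint a p) ∘ p.1) := by
  intro r s h
  have h1 := latticePoint_add_le a p h
  simp only [Function.comp, sortKey, Prod.Lex.toLex_lt_toLex]
  have h2 : (0 : ℤ) ≤ a (p.1 r) := by positivity
  have h3 : p.1 r ≠ p.1 s := fun e => h.ne (p.1.injective e)
  split_ifs at h1 with c
  · left; omega
  · rcases (show latticePoint a p (p.1 r) ≤ latticePoint a p (p.1 s) by omega).eq_or_lt with e | e
    · exact Or.inr ⟨e, lt_of_le_of_ne (not_lt.1 c) h3⟩
    · exact Or.inl e

theorem latticePoint_injective (a : Fin n → ℕ) : Function.Injective (latticePoint a) := by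
  intro p p' h
  have h1 := strictMono_sortKey_latticePoint a p
  have h2 := strictMono_sortKey_latticePoint a p'
  rw [← h] at h2
  have h3 : sortKey (latticePoint a p) ∘ p.1 = sortKey (latticePoint a p) ∘ p'.1 := by
    rw [← h1.range_inj h2, Set.range_comp, Set.range_comp, p.1.surjective.range_eq, p'.1.surjective.range_eq]
  have h4 : p.1 = p'.1 := by
    ext1 r
    exact sortKey_injective _ (congrFun h3 r)
  obtain ⟨π, m⟩ := p
  obtain ⟨π', m'⟩ := p'
  obtain rfl : π = π' := h4
  congr 1
  apply partialSum_injective π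
  intro r
  have h5 := congrFun h (π r)
  rw [latticePoint_apply a (π, m), latticePoint_apply a (π, m')] at h5
  simpa using h5

/-! ### Where the `q`-Dyson product vanishes at powers of `q` -/

theorem X_zpow_eq_one_iff (z : ℤ) : (RatFunc.X : K) ^ z = 1 ↔ z = 0 := by
  have key : ∀ k : ℕ, (RatFunc.X : K) ^ k = 1 → k = 0 := by
    intro k h
    rw [← RatFunc.algebraMap_X, ← map_pow, ← map_one (algebraMap (Polynomial ℚ) K)] at h
    have h1 := RatFunc.algebraMap_injective ℚ h
    have h2 := congrArg Polynomial.natDegree h1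
    simpa using h2
  constructor
  · intro h
    rcases Int.eq_nat_or_neg z with ⟨k, rfl | rfl⟩
    · rw [zpow_natCast] at h; simp [key k h]
    · rw [zpow_neg, inv_eq_one, zpow_natCast] at h; simp [key k h]
  · rintro rfl; simp

theorem qPoch_X_ne_zero_iff (e : ℤ) (k : ℕ) :
    qPoch (RatFunc.X : K) (RatFunc.X ^ e) k ≠ 0 ↔ (0 < e ∨ e + k ≤ 0) := by
  rw [qPoch, Finset.prod_ne_zero_iff]
  have h1 : ∀ t : ℕ, (1 - (RatFunc.X : K) ^ t * RatFunc.X ^ e ≠ 0) ↔ (t : ℤ) + e ≠ 0 := by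
    intro t
    rw [sub_ne_zero, ← zpow_natCast, ← zpow_add₀ RatFunc.X_ne_zero, ne_comm, Ne,
      X_zpow_eq_one_iff]
  simp only [h1, Finset.mem_range]
  constructor
  · intro h
    by_contra! hc
    exact h e.natAbs (by omega) (by omega)
  · rintro h t ht
    omega

/-- The two Pochhammer symbols of a pair `i < j` vanish on adjacent windows of exponents; together
they exclude `α_j - a_i < α_i ≤ α_j + a_j`. The extra `q` in the second symbol produces the `+ 1`,
hence the asymmetry that descents record. -/
theorem qDysonAt_ne_zero_iff (a : Fin n → ℕ) (α : Fin n → ℤ) :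
    qDysonAt a α ≠ 0 ↔ ∀ i j, i < j → α i + a i ≤ α j ∨ α j + a j + 1 ≤ α i := by
  have hX : ∀ e : ℤ, (RatFunc.X : K) * RatFunc.X ^ e = RatFunc.X ^ (1 + e) := by
    intro e; rw [zpow_add₀ RatFunc.X_ne_zero, zpow_one]
  simp only [qDysonAt, qDysonProd, Finset.prod_ne_zero_iff, Finset.mem_univ, true_implies,
    Finset.mem_Ioi, mul_ne_zero_iff, hX, qPoch_X_ne_zero_iff]
  refine forall_congr' fun i => forall_congr' fun j => forall_congr' fun _ => ?_
  omega

theorem qDysonAt_latticePoint_ne_zero (a : Fin n → ℕ) (p : Equiv.Perm (Fin n) × (Fin n → ℕ)) :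
    qDysonAt a (latticePoint a p) ≠ 0 := by
  rw [qDysonAt_ne_zero_iff]
  intro i j hij
  obtain ⟨r, rfl⟩ := p.1.surjective i
  obtain ⟨s, rfl⟩ := p.1.surjective j
  rcases lt_trichotomy r s with h | h | h
  · left
    have := latticePoint_add_le a p h
    rw [if_neg hij.not_gt] at this
    linarith
  · exact absurd hij (by simp [h])
  · right
    have := latticePoint_add_le a p h
    rw [if_pos hij] at this
    linarith

theorem exists_latticePoint_eq (a : Fin n → ℕ) (α : Fin n → ℤ) (h0 : ∀ i, 0 ≤ α i)
    (h : qDysonAt a α ≠ 0) :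
    ∃ p : Equiv.Perm (Fin n) × (Fin n → ℕ), latticePoint a p = α := by
  rw [qDysonAt_ne_zero_iff] at h
  set π : Equiv.Perm (Fin n) := Tuple.sort (sortKey α) with hπ
  have hmono : StrictMono (sortKey α ∘ π) :=
    (Tuple.monotone_sort (sortKey α)).strictMono_of_injective
      ((sortKey_injective α).comp π.injective)
  -- Of the two alternatives given by non-vanishing, sorting rules out the one that would place `π
  -- s` before `π r`.
  have hgap : ∀ r s, r < s → α (π r) + a (π r) + (if π s < π r then 1 else 0) ≤ α (π s) := by
    intro r s hrs
    have h1 := hmono hrs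
    simp only [Function.comp, sortKey, Prod.Lex.toLex_lt_toLex] at h1
    rcases lt_or_gt_of_ne (show π r ≠ π s from fun e => hrs.ne (π.injective e)) with c | c
    · rw [if_neg c.not_gt]
      rcases h _ _ c with h2 | h2
      · linarith
      · rcases h1 with h1 | h1 <;> omega
    · rw [if_pos c]
      rcases h _ _ c with h2 | h2
      · rcases h1 with h1 | ⟨h1, h3⟩
        · omega
        · exact absurd h3 c.not_gt
      · linarith
  -- `M` is what the partial sums must be, and `m` is its sequence of increments with descents
  -- removed. By `hgap` and `h0` these are non-negative, so `toNat` loses nothing.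
  let M : Fin n → ℤ := fun r => α (π r) - ∑ t ∈ Finset.Iio r, (a (π t) : ℤ)
  let m : Fin n → ℕ := fun r => if hr : r.val = 0 then (M r).toNat else
    (M r - M ⟨r.val - 1, by omega⟩ - if π r < π ⟨r.val - 1, by omega⟩ then 1 else 0).toNat
  have hM : ∀ k (hk : k < n), (partialSum π m ⟨k, hk⟩ : ℤ) = M ⟨k, hk⟩ := by
    intro k
    induction k with
    | zero =>
      intro hk
      rw [partialSum_zero]
      have : Finset.Iio (⟨0, hk⟩ : Fin n) = ∅ := by ext t; simp [Fin.lt_def]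
      simp [m, M, this, h0]
    | succ k ih =>
      intro hk
      have h1 := hgap ⟨k, by omega⟩ ⟨k + 1, hk⟩ (by simp [Fin.lt_def])
      have h2 : Finset.Iio (⟨k + 1, hk⟩ : Fin n) =
          insert ⟨k, by omega⟩ (Finset.Iio ⟨k, by omega⟩) := by
        ext t; simp only [Finset.mem_insert, Finset.mem_Iio, Fin.lt_def, Fin.ext_iff]; omega
      have h3 : M ⟨k, by omega⟩ + (if π ⟨k + 1, hk⟩ < π ⟨k, by omega⟩ then 1 else 0) ≤
          M ⟨k + 1, hk⟩ := by
        simp only [M]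
        rw [h2, Finset.sum_insert (by simp)]
        linarith
      rw [partialSum_succ]
      have h4 : m ⟨k + 1, hk⟩ = (M ⟨k + 1, hk⟩ - M ⟨k, by omega⟩ -
          if π ⟨k + 1, hk⟩ < π ⟨k, by omega⟩ then 1 else 0).toNat := by
        simp [m]
      push_cast
      rw [h4, ih (by omega), Int.toNat_of_nonneg (by linarith)]
      ring
  refine ⟨(π, m), ?_⟩
  funext i
  obtain ⟨r, rfl⟩ := π.surjective i
  rw [latticePoint_apply a (π, m), hM r.val r.isLt]
  simp [M]

/-! ### The grid and feasibility -/

theorem latticePoint_nonneg (a : Fin n → ℕ) (p : Equiv.Perm (Fin n) × (Fin n → ℕ)) (i : Fin n) :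
    0 ≤ latticePoint a p i := by
  unfold latticePoint; positivity

theorem sum_eq_Iio_add_Ioi (f : Fin n → ℤ) (r : Fin n) :
    ∑ t, f t = ∑ t ∈ Finset.Iio r, f t + f r + ∑ t ∈ Finset.Ioi r, f t := by
  have h : (Finset.univ : Finset (Fin n)) = insert r (Finset.Iio r ∪ Finset.Ioi r) := by
    ext t
    simp only [Finset.mem_univ, Finset.mem_insert, Finset.mem_union, Finset.mem_Iio,
      Finset.mem_Ioi, true_iff]
    exact (lt_trichotomy t r).elim (fun h => Or.inr (Or.inl h))
      (fun h => h.elim Or.inl fun h => Or.inr (Or.inr h))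
  rw [h, Finset.sum_insert (by simp), Finset.sum_union]
  · ring
  · rw [Finset.disjoint_left]; intro t; simp; exact fun h => h.le

theorem latticePoint_le_iff (δ : Fin n → ℤ) (a : Fin n → ℕ)
    (p : Equiv.Perm (Fin n) × (Fin n → ℕ)) (r : Fin n) :
    latticePoint a p (p.1 r) ≤ (∑ j, (a j : ℤ)) - a (p.1 r) + δ (p.1 r) ↔
      (partialSum p.1 p.2 r : ℤ) ≤ δ (p.1 r) + ∑ t ∈ Finset.Ioi r, (a (p.1 t) : ℤ) := by
  rw [latticePoint_apply, ← Equiv.sum_comp p.1, sum_eq_Iio_add_Ioi _ r]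
  constructor <;> intro h <;> linarith

/-- At the last position no `a_{π(t)}` remain to the right, so the grid bound there no longer
involves `a` and becomes feasibility. -/
theorem feasible_of_inGrid (δ : Fin n → ℤ) (a : Fin n → ℕ)
    (p : Equiv.Perm (Fin n) × (Fin n → ℕ)) (h : InGrid δ a (latticePoint a p)) :
    Feasible δ p.1 p.2 := by
  intro l hl
  have h1 := (latticePoint_le_iff δ a p l).1 (h (p.1 l)).2
  have h2 : Finset.Ioi l = ∅ := by
    ext t; simp only [Finset.mem_Ioi, Fin.lt_def, Finset.notMem_empty, iff_false]; omega
  rw [partialSum_last _ _ l hl, h2] at h1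
  push_cast at h1
  simpa using h1

theorem qDysonAt_ne_zero_iff_exists (δ : Fin n → ℤ) (a : Fin n → ℕ) (α : Fin n → ℤ)
    (hα : InGrid δ a α) :
    qDysonAt a α ≠ 0 ↔ ∃ p : Equiv.Perm (Fin n) × (Fin n → ℕ),
      Feasible δ p.1 p.2 ∧ latticePoint a p = α := by
  constructor
  · intro h
    obtain ⟨p, rfl⟩ := exists_latticePoint_eq a α (fun i => (hα i).1) h
    exact ⟨p, feasible_of_inGrid δ a p hα, rfl⟩
  · rintro ⟨p, -, rfl⟩
    exact qDysonAt_latticePoint_ne_zero a p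

/-- Before the last position `l`, the room to the right is at least `a_{π(l)} ≥ |δ_{π(l)}| +
|δ_{π(r)}|`, which absorbs a negative `δ_{π(r)}` as well as `M_r ≤ M_l ≤ δ_{π(l)}`. -/
theorem inGrid_latticePoint (δ : Fin n → ℤ) (a : Fin n → ℕ) (ha : ∀ i, ∑ j, |δ j| ≤ (a i : ℤ))
    (p : Equiv.Perm (Fin n) × (Fin n → ℕ)) (hp : Feasible δ p.1 p.2) :
    InGrid δ a (latticePoint a p) := by
  intro i
  refine ⟨latticePoint_nonneg a p i, ?_⟩
  obtain ⟨r, rfl⟩ := p.1.surjective i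
  rw [latticePoint_le_iff]
  have hn : 0 < n := r.pos
  set l : Fin n := ⟨n - 1, by omega⟩ with hl
  have hl' : l.val + 1 = n := by simp [l]; omega
  have h1 := hp l hl'
  have h2 : (partialSum p.1 p.2 l : ℤ) ≤ δ (p.1 l) := by
    rw [partialSum_last _ _ l hl']; push_cast; exact h1
  have hrl : r ≤ l := by simp only [Fin.le_def, l]; omega
  have h3 := partialSum_mono p.1 p.2 hrl
  rcases hrl.eq_or_lt with e | h
  · have : (0 : ℤ) ≤ ∑ t ∈ Finset.Ioi r, (a (p.1 t) : ℤ) := by positivity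
    rw [← e] at h2
    linarith
  · have h4 : (a (p.1 l) : ℤ) ≤ ∑ t ∈ Finset.Ioi r, (a (p.1 t) : ℤ) :=
      Finset.single_le_sum (f := fun t => (a (p.1 t) : ℤ)) (fun _ _ => by positivity) (by simpa)
    have h5 : |δ (p.1 l)| + |δ (p.1 r)| ≤ ∑ j, |δ j| := by
      rw [← Finset.sum_pair (f := fun j => |δ j|) (fun e => h.ne' (p.1.injective e))]
      exact Finset.sum_le_sum_of_subset_of_nonneg (Finset.subset_univ _)
        (fun _ _ _ => abs_nonneg _)
    have h6 := ha (p.1 l)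
    have h7 := le_abs_self (δ (p.1 l))
    have h8 := neg_abs_le (δ (p.1 r))
    have h9 : (partialSum p.1 p.2 r : ℤ) ≤ partialSum p.1 p.2 l := by exact_mod_cast h3
    linarith

/-! ### Evaluation and support of Laurent polynomials -/

theorem map_qPoch {A B : Type*} [CommRing A] [CommRing B] (f : A →+* B) (q y : A) (k : ℕ) :
    f (qPoch q y k) = qPoch (f q) (f y) k := by
  simp [qPoch, map_prod]

theorem map_qDysonProd {A B : Type*} [CommRing A] [CommRing B] (f : A →+* B) (q : A)
    (ratio : Fin n → Fin n → A) (a : Fin n → ℕ) :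
    f (qDysonProd q ratio a) = qDysonProd (f q) (fun i j => f (ratio i j)) a := by
  simp [qDysonProd, map_prod, map_qPoch]

theorem prod_zpow_eq_zpow_sum {ι F : Type*} [Field F] {q : F} (hq : q ≠ 0) (s : Finset ι)
    (f : ι → ℤ) : ∏ i ∈ s, q ^ f i = q ^ ∑ i ∈ s, f i := by
  classical
  induction s using Finset.induction_on with
  | empty => simp
  | insert i s hi ih => rw [Finset.prod_insert hi, Finset.sum_insert hi, zpow_add₀ hq, ih]

/-- Evaluation of Laurent polynomials at `x_i = q^{α_i}`. -/
noncomputable def evalPoint (α : Fin n → ℤ) : Laurent n →ₐ[K] K :=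
  AddMonoidAlgebra.lift K K (Fin n → ℤ)
    { toFun := fun e => RatFunc.X ^ ∑ i, α i * e.toAdd i
      map_one' := by simp
      map_mul' := fun e f => by
        rw [← zpow_add₀ RatFunc.X_ne_zero, ← Finset.sum_add_distrib]
        simp [mul_add] }

theorem evalPoint_single (α e : Fin n → ℤ) (c : K) :
    evalPoint α (AddMonoidAlgebra.single e c) = c * RatFunc.X ^ ∑ i, α i * e i := by
  rw [evalPoint, AddMonoidAlgebra.lift_single]; rfl

theorem evalPoint_eq_sum (α : Fin n → ℤ) (f : Laurent n) :
    evalPoint α f = ∑ e ∈ f.coeff.support, f.coeff e * RatFunc.X ^ ∑ i, α i * e i := by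
  rw [evalPoint, AddMonoidAlgebra.lift_apply]; rfl

theorem evalPoint_qDyson (α : Fin n → ℤ) (a : Fin n → ℕ) :
    evalPoint α (qDyson a) = qDysonAt a α := by
  have h := map_qDysonProd (evalPoint α).toRingHom (algebraMap K (Laurent n) RatFunc.X) xRatio a
  simp only [AlgHom.toRingHom_eq_coe, RingHom.coe_coe, AlgHom.commutes] at h
  rw [qDyson, h, qDysonAt]
  congr 1
  funext i j
  rw [xRatio, evalPoint_single, one_mul]
  congr 1
  simp [mul_sub, Finset.sum_sub_distrib, Pi.single_apply]

/-- `f` is homogeneous of degree `0`, and `x^w f` is a polynomial. -/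
def SuppBound (w : Fin n → ℤ) (f : Laurent n) : Prop :=
  ∀ e, f.coeff e ≠ 0 → ∑ i, e i = 0 ∧ ∀ i, -w i ≤ e i

theorem SuppBound.one : SuppBound (0 : Fin n → ℤ) (1 : Laurent n) := by
  intro e he
  rw [AddMonoidAlgebra.one_def, AddMonoidAlgebra.coeff_single, Finsupp.single_apply] at he
  have : e = 0 := by
    by_contra h; exact he (if_neg (Ne.symm h))
  simp [this]

theorem SuppBound.mul {w w' : Fin n → ℤ} {f g : Laurent n} (hf : SuppBound w f)
    (hg : SuppBound w' g) : SuppBound (w + w') (f * g) := by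
  classical
  intro e he
  have h := AddMonoidAlgebra.support_coeff_mul_subset f g (Finsupp.mem_support_iff.2 he)
  obtain ⟨u, hu, v, hv, rfl⟩ := Finset.mem_add.1 h
  obtain ⟨h1, h2⟩ := hf u (Finsupp.mem_support_iff.1 hu)
  obtain ⟨h3, h4⟩ := hg v (Finsupp.mem_support_iff.1 hv)
  refine ⟨by simp [Finset.sum_add_distrib, h1, h3], fun i => ?_⟩
  have := h2 i
  have := h4 i
  simp only [Pi.add_apply]
  linarith

theorem SuppBound.prod {ι : Type*} (s : Finset ι) (w : ι → Fin n → ℤ) (f : ι → Laurent n)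
    (h : ∀ i ∈ s, SuppBound (w i) (f i)) : SuppBound (∑ i ∈ s, w i) (∏ i ∈ s, f i) := by
  classical
  induction s using Finset.induction_on with
  | empty => simpa using SuppBound.one
  | insert i s hi ih =>
    rw [Finset.sum_insert hi, Finset.prod_insert hi]
    exact (h i (by simp)).mul (ih fun j hj => h j (by simp [hj]))

theorem SuppBound.one_sub (c : K) (i j : Fin n) (h : i ≠ j) :
    SuppBound (Pi.single j 1) (1 - algebraMap K (Laurent n) c * xRatio i j) := by
  intro e he
  have h1 : algebraMap K (Laurent n) c * xRatio i j =
      AddMonoidAlgebra.single (Pi.single i 1 - Pi.single j 1) c := by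
    rw [xRatio, ← Algebra.smul_def, AddMonoidAlgebra.smul_single, smul_eq_mul, mul_one]
  rw [h1, AddMonoidAlgebra.one_def, AddMonoidAlgebra.coeff_sub, AddMonoidAlgebra.coeff_single,
    AddMonoidAlgebra.coeff_single, Finsupp.sub_apply, Finsupp.single_apply,
    Finsupp.single_apply] at he
  by_cases h2 : (0 : Fin n → ℤ) = e
  · subst h2
    refine ⟨by simp, fun k => ?_⟩
    rcases eq_or_ne k j with rfl | hk <;> simp [*]
  · by_cases h3 : (Pi.single i 1 - Pi.single j 1 : Fin n → ℤ) = e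
    · subst h3
      refine ⟨by simp [Finset.sum_sub_distrib], fun k => ?_⟩
      rcases eq_or_ne k j with rfl | hk
      · simp [h.symm]
      · rcases eq_or_ne k i with rfl | hk' <;> simp [*]
    · simp [h2, h3] at he

theorem SuppBound.qPoch (c : K) (i j : Fin n) (h : i ≠ j) (k : ℕ) :
    SuppBound (Pi.single j (k : ℤ)) (QDyson.qPoch (algebraMap K (Laurent n) RatFunc.X)
      (algebraMap K (Laurent n) c * xRatio i j) k) := by
  have h1 := SuppBound.prod (Finset.range k) (fun _ => Pi.single j 1)
    (fun t => 1 - algebraMap K (Laurent n) (RatFunc.X ^ t * c) * xRatio i j)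
    (fun t _ => SuppBound.one_sub _ i j h)
  have h2 : ∑ _t ∈ Finset.range k, (Pi.single j 1 : Fin n → ℤ) = Pi.single j (k : ℤ) := by
    rw [Finset.sum_const, Finset.card_range]
    ext l; simp [Pi.single_apply]
  rw [h2] at h1
  simpa only [QDyson.qPoch, map_mul, map_pow, mul_assoc] using h1

/-- For each pair `i < j` the symbols contribute at worst `x_j^{-a_i}` and `x_i^{-a_j}`; hence `x_k`
occurs to exponent at least `-∑_{t ≠ k} a_t`. -/
theorem suppBound_qDyson (a : Fin n → ℕ) :
    SuppBound (fun i => (∑ j, (a j : ℤ)) - a i) (qDyson a) := by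
  have h : SuppBound (∑ i, ∑ j ∈ Finset.Ioi i,
      ((Pi.single j (a i : ℤ) : Fin n → ℤ) + Pi.single i (a j : ℤ))) (qDyson a) := by
    rw [qDyson, qDysonProd]
    refine SuppBound.prod _ _ _ fun i _ => SuppBound.prod _ _ _ fun j hj => SuppBound.mul ?_ ?_
    · have := SuppBound.qPoch 1 i j (Finset.mem_Ioi.1 hj).ne (a i)
      rw [map_one, one_mul] at this
      exact this
    · exact SuppBound.qPoch RatFunc.X j i (Finset.mem_Ioi.1 hj).ne' (a j)
  convert h using 1
  funext k
  simp only [Finset.sum_apply, Pi.add_apply, Pi.single_apply, Finset.sum_add_distrib]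
  rw [sum_eq_Iio_add_Ioi _ k]
  have h1 : ∑ i, ∑ j ∈ Finset.Ioi i, (if k = j then (a i : ℤ) else 0) =
      ∑ t ∈ Finset.Iio k, (a t : ℤ) := by
    simp only [Finset.sum_ite_eq, Finset.mem_Ioi]
    rw [← Finset.sum_filter]
    congr 1
    ext t; simp
  have h2 : ∑ i, ∑ j ∈ Finset.Ioi i, (if k = i then (a j : ℤ) else 0) =
      ∑ t ∈ Finset.Ioi k, (a t : ℤ) := by
    rw [Finset.sum_eq_single k]
    · simp
    · intro b _ hb; simp [hb.symm]
    · simp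
  rw [h1, h2]; ring

/-! ### Coefficient extraction by Lagrange interpolation -/

theorem X_zpow_injective : Function.Injective fun z : ℤ => (RatFunc.X : K) ^ z := by
  intro x y h
  have h1 : (RatFunc.X : K) ^ (x - y) = 1 := by
    rw [zpow_sub₀ RatFunc.X_ne_zero]
    exact div_eq_one_iff_eq (zpow_ne_zero _ RatFunc.X_ne_zero) |>.2 h
  linarith [(X_zpow_eq_one_iff _).1 h1]

/-- The derivative at the node `q^α` of the polynomial with simple roots `1, q, …, q^d`. -/
noncomputable def nodeWeight (d α : ℤ) : K :=
  ∏ β ∈ (Finset.Icc 0 d).erase α, (RatFunc.X ^ α - RatFunc.X ^ β)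

/-- The left side is Lagrange's formula for the coefficient of `X^d` in the polynomial `X^k`,
interpolated at the `d + 1` nodes `1, q, …, q^d`. -/
theorem sum_zpow_div_nodeWeight (d k : ℤ) (h0 : 0 ≤ k) (hk : k ≤ d) :
    ∑ α ∈ Finset.Icc 0 d, RatFunc.X ^ (α * k) / nodeWeight d α = if k = d then 1 else 0 := by
  lift k to ℕ using h0
  lift d to ℕ using (le_trans (by positivity) hk)
  have hc : #(Finset.Icc (0 : ℤ) d) = d + 1 := by simp
  have h := Lagrange.coeff_eq_sum (F := K) (s := Finset.Icc (0 : ℤ) d)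
    (v := fun z : ℤ => (RatFunc.X : K) ^ z) (P := Polynomial.X ^ k)
    (X_zpow_injective.injOn) (by
      rw [Polynomial.degree_X_pow, hc]; norm_cast at hk ⊢; omega)
  rw [hc, Nat.add_sub_cancel, Polynomial.coeff_X_pow] at h
  simp only [Nat.cast_inj, nodeWeight, zpow_mul, zpow_natCast]
  simp only [Polynomial.eval_pow, Polynomial.eval_X] at h
  rw [← h]
  simp only [eq_comm]

/-- The lattice points `α` with `0 ≤ α_i ≤ σ - a_i + δ_i`. -/
noncomputable def grid (δ : Fin n → ℤ) (a : Fin n → ℕ) : Finset (Fin n → ℤ) :=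
  Fintype.piFinset fun i => Finset.Icc 0 ((∑ j, (a j : ℤ)) - a i + δ i)

theorem mem_grid (δ : Fin n → ℤ) (a : Fin n → ℕ) (α : Fin n → ℤ) :
    α ∈ grid δ a ↔ InGrid δ a α := by
  simp [grid, InGrid]

theorem prod_sum_zpow_div_nodeWeight {w e δ : Fin n → ℤ} (he : ∑ i, e i = 0)
    (hw : ∀ i, -w i ≤ e i) (hδ : ∑ i, δ i = 0) :
    ∏ i, ∑ x ∈ Finset.Icc 0 (w i + δ i), RatFunc.X ^ (x * (e i + w i)) /
      nodeWeight (w i + δ i) x = if e = δ then (1 : K) else 0 := by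
  split_ifs with h
  · subst h
    refine Finset.prod_eq_one fun i _ => ?_
    rw [sum_zpow_div_nodeWeight _ _ (by linarith [hw i]) (by linarith), if_pos (by ring)]
  -- Both exponent vectors have sum zero, so `e ≠ δ` is strictly smaller in some coordinate. The
  -- factor of that coordinate vanishes, and the other factors need no degree bound.
  · obtain ⟨i, hi⟩ : ∃ i, e i < δ i := by
      by_contra! hc
      refine h (funext fun i => ?_)
      have h3 := (Finset.sum_eq_sum_iff_of_le (s := Finset.univ) (fun i _ => hc i)).1
        (by rw [he, hδ])
      exact (h3 i (Finset.mem_univ _)).symm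
    refine Finset.prod_eq_zero (Finset.mem_univ i) ?_
    rw [sum_zpow_div_nodeWeight _ _ (by linarith [hw i]) (by linarith), if_neg (by
      intro h; linarith)]

theorem evalPoint_mul_prod_div (w d α : Fin n → ℤ) (f : Laurent n) :
    evalPoint α f * ∏ i, (RatFunc.X ^ (α i * w i) / nodeWeight (d i) (α i)) =
      ∑ e ∈ f.coeff.support, f.coeff e *
        ∏ i, (RatFunc.X ^ (α i * (e i + w i)) / nodeWeight (d i) (α i)) := by
  rw [evalPoint_eq_sum, Finset.sum_mul]
  refine Finset.sum_congr rfl fun e _ => ?_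
  rw [mul_assoc, ← prod_zpow_eq_zpow_sum RatFunc.X_ne_zero, ← Finset.prod_mul_distrib]
  congr 1
  refine Finset.prod_congr rfl fun i _ => ?_
  rw [mul_add, zpow_add₀ RatFunc.X_ne_zero, mul_div_assoc]

theorem SuppBound.coeff_eq_sum {w : Fin n → ℤ} {f : Laurent n} (hf : SuppBound w f)
    {δ : Fin n → ℤ} (hδ : ∑ i, δ i = 0) :
    f.coeff δ = ∑ α ∈ Fintype.piFinset fun i => Finset.Icc 0 (w i + δ i),
      evalPoint α f * ∏ i, (RatFunc.X ^ (α i * w i) / nodeWeight (w i + δ i) (α i)) := by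
  rw [Finset.sum_congr rfl fun α _ => evalPoint_mul_prod_div w (fun i => w i + δ i) α f,
    Finset.sum_comm]
  have key : ∀ e ∈ f.coeff.support, ∑ α ∈ Fintype.piFinset fun i => Finset.Icc 0 (w i + δ i),
      f.coeff e * ∏ i, (RatFunc.X ^ (α i * (e i + w i)) / nodeWeight (w i + δ i) (α i)) =
      if e = δ then f.coeff δ else 0 := by
    intro e he
    obtain ⟨h1, h2⟩ := hf e (Finsupp.mem_support_iff.1 he)
    have h3 := prod_sum_zpow_div_nodeWeight h1 h2 hδ
    rw [Finset.prod_univ_sum] at h3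
    rw [← Finset.mul_sum, h3]
    split_ifs with h
    · rw [h, mul_one]
    · rw [mul_zero]
  rw [Finset.sum_congr rfl key, Finset.sum_ite_eq']
  split_ifs with h
  · rfl
  · exact Finsupp.notMem_support_iff.1 h

theorem coeff_qDyson_eq_sum (a : Fin n → ℕ) {δ : Fin n → ℤ} (hδ : ∑ i, δ i = 0) :
    (qDyson a).coeff δ = ∑ α ∈ grid δ a, qDysonAt a α *
      ∏ i, (RatFunc.X ^ (α i * ((∑ j, (a j : ℤ)) - a i)) /
        nodeWeight ((∑ j, (a j : ℤ)) - a i + δ i) (α i)) := by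
  rw [(suppBound_qDyson a).coeff_eq_sum hδ]
  simp only [evalPoint_qDyson]
  rfl

/-! ### Values of Pochhammer symbols at powers of `q` -/

/-- `(q)_k` in `ℚ(q)`. -/
noncomputable def qFact (k : ℕ) : K := qPoch RatFunc.X RatFunc.X k

theorem qFact_eq_prod (k : ℕ) : qFact k = ∏ t ∈ Finset.range k, (1 - RatFunc.X ^ (t + 1)) := by
  simp [qFact, qPoch, pow_succ]

theorem one_sub_X_pow_ne_zero {k : ℕ} (hk : 0 < k) : 1 - (RatFunc.X : K) ^ k ≠ 0 := by
  rw [sub_ne_zero, ← zpow_natCast, ne_comm, Ne, X_zpow_eq_one_iff]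
  exact_mod_cast hk.ne'

theorem qFact_ne_zero (k : ℕ) : qFact k ≠ 0 := by
  rw [qFact_eq_prod, Finset.prod_ne_zero_iff]
  exact fun t _ => one_sub_X_pow_ne_zero t.succ_pos

theorem qFact_zero : qFact 0 = 1 := by simp [qFact_eq_prod]

theorem qFact_add (k l : ℕ) :
    qFact (k + l) = qFact k * ∏ t ∈ Finset.range l, (1 - RatFunc.X ^ (k + t + 1)) := by
  rw [qFact_eq_prod, qFact_eq_prod, Finset.prod_range_add]

theorem prod_range_X_pow (k c : ℕ) :
    ∏ t ∈ Finset.range k, (RatFunc.X : K) ^ (c + t) = RatFunc.X ^ (k * c + k.choose 2) := by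
  rw [Finset.prod_pow_eq_pow_sum, Finset.sum_add_distrib, Finset.sum_range_id,
    Nat.choose_two_right]
  simp

theorem qPoch_X_X_zpow_succ (c k : ℕ) :
    qPoch (RatFunc.X : K) (RatFunc.X ^ (c + 1)) k = qFact (c + k) / qFact c := by
  rw [qFact_add, mul_div_cancel_left₀ _ (qFact_ne_zero c), qPoch]
  refine Finset.prod_congr rfl fun t _ => ?_
  ring

theorem qPoch_X_zpow_neg (c k : ℕ) :
    qPoch (RatFunc.X : K) (RatFunc.X ^ (-((k + c : ℕ) : ℤ))) k =
      (-1) ^ k * RatFunc.X ^ (-((k * c + (k + 1).choose 2 : ℕ) : ℤ)) *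
        (qFact (c + k) / qFact c) := by
  have hX := RatFunc.X_ne_zero (K := ℚ)
  rw [qFact_add, mul_div_cancel_left₀ _ (qFact_ne_zero c), qPoch, ← Finset.prod_range_reflect]
  have h1 : ∀ t ∈ Finset.range k, (1 - (RatFunc.X : K) ^ (k - 1 - t) *
      RatFunc.X ^ (-((k + c : ℕ) : ℤ))) =
      (-1) * (RatFunc.X ^ (c + 1 + t))⁻¹ * (1 - RatFunc.X ^ (c + t + 1)) := by
    intro t ht
    have ht' := Finset.mem_range.1 ht
    have : (RatFunc.X : K) ^ (k - 1 - t) * RatFunc.X ^ (-((k + c : ℕ) : ℤ)) =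
        (RatFunc.X ^ (c + 1 + t))⁻¹ := by
      rw [← zpow_natCast, ← zpow_natCast, ← zpow_neg, ← zpow_add₀ hX]
      congr 1
      push_cast [Nat.cast_sub (show t ≤ k - 1 by omega), Nat.cast_sub (show 1 ≤ k by omega)]
      ring
    rw [this]
    have h2 : (RatFunc.X : K) ^ (c + 1 + t) ≠ 0 := pow_ne_zero _ hX
    have h3 : c + t + 1 = c + 1 + t := by ring
    rw [h3]
    field_simp
    ring
  rw [Finset.prod_congr rfl h1, Finset.prod_mul_distrib, Finset.prod_mul_distrib,
    Finset.prod_const, Finset.card_range, Finset.prod_inv_distrib, prod_range_X_pow, zpow_neg,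
    zpow_natCast]
  have h4 : k * (c + 1) + k.choose 2 = k * c + (k + 1).choose 2 := by
    rw [Nat.choose_succ_succ' k 1, Nat.choose_one_right]; ring
  rw [h4]

/-- The nodes below `q^k` give the sign, `q^{k.choose 2}` and `(q)_k`; the `b` nodes above give
`q^{kb} (q)_b`. -/
theorem nodeWeight_eq (k b : ℕ) :
    nodeWeight ((k + b : ℕ) : ℤ) k =
      (-1) ^ k * RatFunc.X ^ (k.choose 2 + k * b) * qFact k * qFact b := by
  have h1 : (Finset.Icc 0 ((k + b : ℕ) : ℤ)).erase k =
      (Finset.range k).image (fun t => ((t : ℕ) : ℤ)) ∪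
        (Finset.range b).image (fun t => ((k + t + 1 : ℕ) : ℤ)) := by
    ext z
    simp only [Finset.mem_erase, Finset.mem_Icc, Finset.mem_union, Finset.mem_image,
      Finset.mem_range]
    constructor
    · rintro ⟨h1, h2, h3⟩
      rcases lt_or_gt_of_ne h1 with h | h
      · exact Or.inl ⟨z.toNat, by omega, by omega⟩
      · exact Or.inr ⟨(z - k - 1).toNat, by omega, by omega⟩
    · rintro (⟨t, h1, rfl⟩ | ⟨t, h1, rfl⟩) <;> omega
  have h2 : Disjoint ((Finset.range k).image (fun t => ((t : ℕ) : ℤ)))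
      ((Finset.range b).image (fun t => ((k + t + 1 : ℕ) : ℤ))) := by
    rw [Finset.disjoint_left]
    intro z
    simp only [Finset.mem_image, Finset.mem_range]
    rintro ⟨t, h1, rfl⟩ ⟨s, h2, h3⟩
    omega
  rw [nodeWeight, h1, Finset.prod_union h2, Finset.prod_image (by intro x _ y _ h; simpa using h),
    Finset.prod_image (by intro x _ y _ h; simpa using h)]
  have h3 : ∏ t ∈ Finset.range k, ((RatFunc.X : K) ^ (k : ℤ) - RatFunc.X ^ (t : ℤ)) =
      (-1) ^ k * RatFunc.X ^ k.choose 2 * qFact k := by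
    have h4 : ∀ t ∈ Finset.range k, ((RatFunc.X : K) ^ (k : ℤ) - RatFunc.X ^ (t : ℤ)) =
        (-1) * RatFunc.X ^ (0 + t) * (1 - RatFunc.X ^ (k - 1 - t + 1)) := by
      intro t ht
      have ht' := Finset.mem_range.1 ht
      rw [zpow_natCast, zpow_natCast, mul_sub, mul_one, mul_assoc _ _ (RatFunc.X ^ (k - 1 - t + 1)),
        ← pow_add, show 0 + t + (k - 1 - t + 1) = k by omega, zero_add]
      ring
    rw [Finset.prod_congr rfl h4, Finset.prod_mul_distrib, Finset.prod_mul_distrib,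
      prod_range_X_pow, Finset.prod_range_reflect (fun t => (1 - (RatFunc.X : K) ^ (t + 1))),
      ← qFact_eq_prod]
    simp
  have h5 : ∏ t ∈ Finset.range b, ((RatFunc.X : K) ^ (k : ℤ) - RatFunc.X ^ ((k + t + 1 : ℕ) : ℤ)) =
      RatFunc.X ^ (k * b) * qFact b := by
    have h4 : ∀ t ∈ Finset.range b, ((RatFunc.X : K) ^ (k : ℤ) -
        RatFunc.X ^ ((k + t + 1 : ℕ) : ℤ)) = RatFunc.X ^ k * (1 - RatFunc.X ^ (t + 1)) := by
      intro t _
      rw [zpow_natCast, zpow_natCast]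
      ring
    rw [Finset.prod_congr rfl h4, Finset.prod_mul_distrib, Finset.prod_const, Finset.card_range,
      ← pow_mul, ← qFact_eq_prod]
  rw [h3, h5]
  ring

/-- This is the reason for the convention on negative indices: one quotient formula covers both
signs as long as `N + c` is non-negative. -/
theorem qPochInt_X_eq_div (N L : ℕ) (c : ℤ) (h : (L : ℤ) = N + c) :
    qPochInt RatFunc.X (RatFunc.X * RatFunc.X ^ N) c = qFact L / qFact N := by
  rw [qPochInt]
  split_ifs with hc
  · lift c to ℕ using hc
    obtain rfl : L = N + c := by exact_mod_cast h
    rw [← pow_succ', Int.toNat_natCast, qPoch_X_X_zpow_succ]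
  · obtain ⟨k, rfl⟩ : ∃ k : ℕ, c = -k := ⟨(-c).toNat, by omega⟩
    obtain rfl : N = L + k := by omega
    rw [neg_neg, Int.toNat_natCast, qFact_add, ← div_div, div_self (qFact_ne_zero _), one_div]
    congr 1
    rw [← Finset.prod_range_reflect, ← Finset.Ico_add_one_right_eq_Icc,
      Finset.prod_Ico_eq_prod_range]
    refine Finset.prod_congr rfl fun t ht => ?_
    have ht' := Finset.mem_range.1 ht
    congr 1
    rw [← pow_succ', inv_mul_eq_iff_eq_mul₀ (pow_ne_zero _ RatFunc.X_ne_zero), ← pow_add]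
    congr 1
    omega

theorem qPochInt_X_eq_zero (N : ℕ) (c : ℤ) (h : (N : ℤ) + c < 0) :
    qPochInt (RatFunc.X : K) (RatFunc.X * RatFunc.X ^ N) c = 0 := by
  rw [qPochInt, if_neg (by omega), inv_eq_zero, Finset.prod_eq_zero_iff]
  -- The factor with `t = N + 1` is `1 - q^{-(N+1)} q^{N+1}`. The symbol has a pole here, so its
  -- value is the default `0⁻¹ = 0`; dividing by it again gives `0`, which is the true value of its
  -- reciprocal.
  refine ⟨N + 1, by simp; omega, ?_⟩
  rw [← pow_succ', inv_mul_cancel₀ (pow_ne_zero _ RatFunc.X_ne_zero), sub_self]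

/-! ### Sums and products over pairs of positions -/

theorem prod_Ioi_comm {F : Type*} [CommMonoid F] (g : Fin n → Fin n → F) :
    ∏ r, ∏ s ∈ Finset.Ioi r, g r s = ∏ s, ∏ r ∈ Finset.Iio s, g r s :=
  Finset.prod_comm' (by simp)

theorem sum_Ioi_comm {F : Type*} [AddCommMonoid F] (g : Fin n → Fin n → F) :
    ∑ r, ∑ s ∈ Finset.Ioi r, g r s = ∑ s, ∑ r ∈ Finset.Iio s, g r s :=
  Finset.sum_comm' (by simp)

theorem prod_Iio_eq_prod_range {F : Type*} [CommMonoid F] (g : ℕ → F) (s : Fin n) :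
    ∏ r ∈ Finset.Iio s, g r = ∏ r ∈ Finset.range s, g r := by
  rw [← Nat.Iio_eq_range, ← Fin.map_valEmbedding_Iio, Finset.prod_map]
  rfl

/-- Unordered pairs of indices are reindexed by unordered pairs of positions; the condition restores
the order of the indices. -/
theorem prod_Ioi_perm {F : Type*} [CommMonoid F] (π : Equiv.Perm (Fin n))
    (g : Fin n → Fin n → F) :
    ∏ i, ∏ j ∈ Finset.Ioi i, g i j =
      ∏ r, ∏ s ∈ Finset.Ioi r, if π s < π r then g (π s) (π r) else g (π r) (π s) := by
  rw [Finset.prod_sigma', Finset.prod_sigma']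
  symm
  refine Finset.prod_bij'
    (fun x _ => if π x.2 < π x.1 then ⟨π x.2, π x.1⟩ else ⟨π x.1, π x.2⟩)
    (fun x _ => if π.symm x.2 < π.symm x.1 then ⟨π.symm x.2, π.symm x.1⟩ else
      ⟨π.symm x.1, π.symm x.2⟩) ?_ ?_ ?_ ?_ ?_
  · rintro ⟨r, s⟩ h
    simp only [Finset.mem_sigma, Finset.mem_univ, Finset.mem_Ioi, true_and] at h ⊢
    split_ifs with c
    · exact c
    · exact lt_of_le_of_ne (not_lt.1 c) fun e => h.ne (π.injective e)
  · rintro ⟨r, s⟩ h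
    simp only [Finset.mem_sigma, Finset.mem_univ, Finset.mem_Ioi, true_and] at h ⊢
    split_ifs with c
    · exact c
    · exact lt_of_le_of_ne (not_lt.1 c) fun e => h.ne (π.symm.injective e)
  · rintro ⟨r, s⟩ h
    simp only [Finset.mem_sigma, Finset.mem_univ, Finset.mem_Ioi, true_and] at h
    by_cases c : π s < π r
    · simp [c, h]
    · simp [c, h.not_gt]
  · rintro ⟨r, s⟩ h
    simp only [Finset.mem_sigma, Finset.mem_univ, Finset.mem_Ioi, true_and] at h
    by_cases c : π.symm s < π.symm r
    · simp [c, h]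
    · simp [c, h.not_gt]
  · rintro ⟨r, s⟩ h
    by_cases c : π s < π r <;> simp [c]

/-- Here `g r s` is a weight of the interval `[r, s)`. Adjoining a last position multiplies by the
intervals ending there, whose denominators cancel the factors `g (r + 1) n` of the previous stage.
-/
theorem prod_interval_telescope {F : Type*} [Field F] (g : ℕ → ℕ → F) (hg : ∀ r s, g r s ≠ 0)
    (h1 : ∀ r, g r r = 1) (n : ℕ) :
    (∏ s ∈ Finset.range n, ∏ r ∈ Finset.range s, g r (s + 1) / g (r + 1) s) *
        ∏ r ∈ Finset.range n, g r (r + 1) =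
      g 0 n * ∏ r ∈ Finset.range n, (g 0 r * g (r + 1) n) := by
  induction n with
  | zero => simp [h1]
  | succ n ih =>
    have h2 : (∏ r ∈ Finset.range n, g r (n + 1)) * g n (n + 1) =
        g 0 (n + 1) * ∏ r ∈ Finset.range n, g (r + 1) (n + 1) := by
      rw [← Finset.prod_range_succ, Finset.prod_range_succ', mul_comm]
    rw [Finset.prod_range_succ, Finset.prod_range_succ (fun r => g r (r + 1)),
      Finset.prod_range_succ _ n, h1, mul_one, Finset.prod_div_distrib]
    have h3 : ∏ r ∈ Finset.range n, g (r + 1) n ≠ 0 := Finset.prod_ne_zero_iff.2 fun _ _ => hg _ _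
    rw [Finset.prod_mul_distrib] at ih ⊢
    calc _ = ((∏ s ∈ Finset.range n, ∏ r ∈ Finset.range s, g r (s + 1) / g (r + 1) s) *
          ∏ r ∈ Finset.range n, g r (r + 1)) *
          ((∏ r ∈ Finset.range n, g r (n + 1)) * g n (n + 1)) /
            ∏ r ∈ Finset.range n, g (r + 1) n := by ring
      _ = _ := by
        rw [ih, h2]
        field_simp

theorem sum_Iio_sq (b : Fin n → ℤ) (s : Fin n) :
    ∑ r ∈ Finset.Iio s, (2 * b r * ∑ t ∈ Finset.Iio r, b t + b r ^ 2) =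
      (∑ r ∈ Finset.Iio s, b r) ^ 2 := by
  obtain ⟨k, hk⟩ := s
  induction k with
  | zero =>
    have : Finset.Iio (⟨0, hk⟩ : Fin n) = ∅ := by ext t; simp [Fin.lt_def]
    simp [this]
  | succ k ih =>
    have h2 : Finset.Iio (⟨k + 1, hk⟩ : Fin n) =
        insert ⟨k, by omega⟩ (Finset.Iio ⟨k, by omega⟩) := by
      ext t; simp only [Finset.mem_insert, Finset.mem_Iio, Fin.lt_def, Fin.ext_iff]; omega
    rw [h2, Finset.sum_insert (by simp), Finset.sum_insert (by simp), ih (by omega)]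
    ring

/-- `block` with `q` and `z` replaced by elements of an arbitrary field. -/
noncomputable def blockWith {F : Type*} [Field F] (q : F) (z : Fin n → F) (π : Equiv.Perm (Fin n))
    (I : Finset (Fin n)) (c : ℤ) : F :=
  qPochInt q (q * ∏ t ∈ I, z (π t)) c

/-- `summand` with `q` and `z` replaced by elements of an arbitrary field. -/
noncomputable def summandWith {F : Type*} [Field F] (q : F) (z : Fin n → F) (δ : Fin n → ℤ)
    (π : Equiv.Perm (Fin n)) (m : Fin n → ℕ) : F :=
  (∏ r, (-1) ^ partialSum π m r *
      q ^ (((partialSum π m r + 1).choose 2 : ℤ) - partialSum π m r * δ (π r)) *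
      z (π r) ^ zExponent δ π m r) *
    (∏ r, ∏ s ∈ Finset.Ioi r,
      blockWith q z π (Finset.Icc r s) (gap π m r s) /
        blockWith q z π (Finset.Ioo r s) (gap π m r s)) /
    ∏ r, (blockWith q z π (Finset.Iio r) (partialSum π m r) *
      blockWith q z π (Finset.Ioi r) (δ (π r) - partialSum π m r))

theorem summand_eq_summandWith (δ : Fin n → ℤ) (π : Equiv.Perm (Fin n)) (m : Fin n → ℕ) :
    summand δ π m = summandWith (qGen n) zGen δ π m := rfl

/-- The value of `summand` at `z_i = q^{a_i}`. -/
noncomputable def summandAt (a : Fin n → ℕ) (δ : Fin n → ℤ) (π : Equiv.Perm (Fin n))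
    (m : Fin n → ℕ) : K :=
  summandWith RatFunc.X (fun i => RatFunc.X ^ a i) δ π m

theorem blockWith_X (a : Fin n → ℕ) (π : Equiv.Perm (Fin n)) (I : Finset (Fin n)) (c : ℤ) :
    blockWith (RatFunc.X : K) (fun i => RatFunc.X ^ a i) π I c =
      qPochInt RatFunc.X (RatFunc.X * RatFunc.X ^ (∑ t ∈ I, a (π t))) c := by
  rw [blockWith, Finset.prod_pow_eq_pow_sum]

theorem blockWith_X_eq (a : Fin n → ℕ) (π : Equiv.Perm (Fin n)) (I : Finset (Fin n)) (c : ℤ)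
    (N L : ℕ) (hN : ∑ t ∈ I, a (π t) = N) (h : (L : ℤ) = N + c) :
    blockWith (RatFunc.X : K) (fun i => RatFunc.X ^ a i) π I c = qFact L / qFact N := by
  rw [blockWith_X, hN, qPochInt_X_eq_div N L c h]

theorem gap_nonneg (π : Equiv.Perm (Fin n)) (m : Fin n → ℕ) {r s : Fin n} (h : r < s) :
    0 ≤ gap π m r s := by
  have := partialSum_add_le π m h
  zify at this
  rw [gap]
  linarith

/-- Leaving the grid at position `r` means `M_r > δ_{π(r)} + ∑_{t>r} a_{π(t)}`, which is where the
reciprocal of the last block symbol has a zero. -/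
theorem summandAt_eq_zero (a : Fin n → ℕ) (δ : Fin n → ℤ) (p : Equiv.Perm (Fin n) × (Fin n → ℕ))
    (h : ¬ InGrid δ a (latticePoint a p)) : summandAt a δ p.1 p.2 = 0 := by
  simp only [InGrid, latticePoint_nonneg, true_and, not_forall] at h
  obtain ⟨i, hi⟩ := h
  obtain ⟨r, rfl⟩ := p.1.surjective i
  rw [latticePoint_le_iff] at hi
  rw [summandAt, summandWith, div_eq_zero_iff]
  right
  refine Finset.prod_eq_zero (Finset.mem_univ r) (mul_eq_zero_of_right _ ?_)
  rw [blockWith_X]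
  apply qPochInt_X_eq_zero
  push_cast
  linarith

/-! ### The value of the `q`-Dyson product at a lattice point -/

theorem latticePoint_sub (a : Fin n → ℕ) (p : Equiv.Perm (Fin n) × (Fin n → ℕ)) {r s : Fin n}
    (h : r < s) :
    latticePoint a p (p.1 s) - latticePoint a p (p.1 r) =
      gap p.1 p.2 r s + (if p.1 s < p.1 r then 1 else 0) + a (p.1 r) +
        ((∑ t ∈ Finset.Ioo r s, a (p.1 t) : ℕ) : ℤ) := by
  have h1 : Finset.Iio s = Finset.Iio r ∪ insert r (Finset.Ioo r s) := by
    ext t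
    simp only [Finset.mem_Iio, Finset.mem_union, Finset.mem_insert, Finset.mem_Ioo]
    constructor
    · intro ht
      rcases lt_trichotomy t r with h' | h' | h'
      · exact Or.inl h'
      · exact Or.inr (Or.inl h')
      · exact Or.inr (Or.inr ⟨h', ht⟩)
    · rintro (h' | rfl | h')
      · exact h'.trans h
      · exact h
      · exact h'.2
  have h2 : Disjoint (Finset.Iio r) (insert r (Finset.Ioo r s)) := by
    rw [Finset.disjoint_left]
    intro t
    simp only [Finset.mem_Iio, Finset.mem_insert, Finset.mem_Ioo]
    rintro h3 (rfl | h4)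
    · exact lt_irrefl _ h3
    · exact lt_asymm h3 h4.1
  rw [latticePoint_apply, latticePoint_apply, h1, Finset.sum_union h2,
    Finset.sum_insert (by simp), gap]
  push_cast
  ring

/-- The value does not depend on whether the pair is inverted: the additional one in the distance
between inverted coordinates compensates for the extra `q` having moved to the other symbol. -/
theorem qDysonAt_pair (a : Fin n → ℕ) (p : Equiv.Perm (Fin n) × (Fin n → ℕ)) {r s : Fin n}
    (h : r < s) (c B : ℕ) (hc : gap p.1 p.2 r s = c) (hB : ∑ t ∈ Finset.Ioo r s, a (p.1 t) = B)
    (g : Fin n → Fin n → K)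
    (hg : ∀ i j, g i j =
      qPoch RatFunc.X (RatFunc.X ^ (latticePoint a p i - latticePoint a p j)) (a i) *
      qPoch RatFunc.X (RatFunc.X * RatFunc.X ^ (latticePoint a p j - latticePoint a p i)) (a j)) :
    (if p.1 s < p.1 r then g (p.1 s) (p.1 r) else g (p.1 r) (p.1 s)) =
      (-1) ^ a (p.1 r) *
        RatFunc.X ^ (-((a (p.1 r) * (c + B) + (a (p.1 r) + 1).choose 2 : ℕ) : ℤ)) *
        (qFact (a (p.1 r) + B + a (p.1 s) + c) / qFact (B + c)) := by
  have hX := RatFunc.X_ne_zero (K := ℚ)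
  have h1 := latticePoint_sub a p h
  rw [hc, hB] at h1
  have h2 : ∀ e : ℤ, (RatFunc.X : K) * RatFunc.X ^ e = RatFunc.X ^ (1 + e) := by
    intro e; rw [zpow_add₀ hX, zpow_one]
  have h3 := qPoch_X_zpow_neg (c + B) (a (p.1 r))
  have h4 := qPoch_X_X_zpow_succ (c + B + a (p.1 r)) (a (p.1 s))
  have hne := qFact_ne_zero (c + B + a (p.1 r))
  have hne' := qFact_ne_zero (c + B)
  have e1 : a (p.1 r) + B + a (p.1 s) + c = c + B + a (p.1 r) + a (p.1 s) := by ring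
  rw [e1, add_comm B c]
  split_ifs at h1 ⊢ with hd
  · have h5 : latticePoint a p (p.1 s) - latticePoint a p (p.1 r) =
        ((c + B + a (p.1 r) + 1 : ℕ) : ℤ) := by rw [h1]; push_cast; ring
    have h6 : 1 + (latticePoint a p (p.1 r) - latticePoint a p (p.1 s)) =
        -((a (p.1 r) + (c + B) : ℕ) : ℤ) := by rw [← neg_sub, h1]; push_cast; ring
    rw [hg, h2, h5, h6, zpow_natCast, h3, h4]
    field_simp
  · have h5 : 1 + (latticePoint a p (p.1 s) - latticePoint a p (p.1 r)) =
        ((c + B + a (p.1 r) + 1 : ℕ) : ℤ) := by rw [h1]; push_cast; ring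
    have h6 : latticePoint a p (p.1 r) - latticePoint a p (p.1 s) =
        -((a (p.1 r) + (c + B) : ℕ) : ℤ) := by rw [← neg_sub, h1]; push_cast; ring
    rw [hg, h2, h5, h6, zpow_natCast, h3, h4]
    field_simp

theorem qDysonAt_eq_prod_pair (a : Fin n → ℕ) (p : Equiv.Perm (Fin n) × (Fin n → ℕ)) :
    qDysonAt a (latticePoint a p) = ∏ r, ∏ s ∈ Finset.Ioi r,
      ((-1) ^ a (p.1 r) *
        RatFunc.X ^ (-((a (p.1 r) * ((gap p.1 p.2 r s).toNat + ∑ t ∈ Finset.Ioo r s, a (p.1 t)) +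
          (a (p.1 r) + 1).choose 2 : ℕ) : ℤ)) *
        (qFact (a (p.1 r) + ∑ t ∈ Finset.Ioo r s, a (p.1 t) + a (p.1 s) +
            (gap p.1 p.2 r s).toNat) /
          qFact (∑ t ∈ Finset.Ioo r s, a (p.1 t) + (gap p.1 p.2 r s).toNat))) := by
  rw [qDysonAt, qDysonProd, prod_Ioi_perm p.1]
  refine Finset.prod_congr rfl fun r _ => Finset.prod_congr rfl fun s hs => ?_
  have h := Finset.mem_Ioi.1 hs
  exact qDysonAt_pair a p h _ _ (Int.toNat_of_nonneg (gap_nonneg _ _ h)).symm rfl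
    (fun i j => qPoch RatFunc.X (RatFunc.X ^ (latticePoint a p i - latticePoint a p j)) (a i) *
      qPoch RatFunc.X (RatFunc.X * RatFunc.X ^ (latticePoint a p j - latticePoint a p i)) (a j))
    fun i j => rfl

/-! ### Telescoping -/

theorem sum_Icc_eq (f : Fin n → ℕ) {r s : Fin n} (h : r < s) :
    ∑ t ∈ Finset.Icc r s, f t = f r + ∑ t ∈ Finset.Ioo r s, f t + f s := by
  have h1 : Finset.Icc r s = insert r (insert s (Finset.Ioo r s)) := by
    rw [← Finset.Ioc_insert_left h.le, ← Finset.Ioo_insert_right h]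
  rw [h1, Finset.sum_insert, Finset.sum_insert (by simp)]
  · ring
  · simp [h.ne]

/-- With `(q)_{sum of f over [r, s)}` as interval weight, this isolates the part of the pair product
that turns into the `q`-multinomial coefficient. -/
theorem prod_qFact_telescope (f : Fin n → ℕ) :
    (∏ r, ∏ s ∈ Finset.Ioi r, qFact (f r + ∑ t ∈ Finset.Ioo r s, f t + f s) /
        qFact (∑ t ∈ Finset.Ioo r s, f t)) * ∏ r, qFact (f r) =
      qFact (∑ t, f t) *
        ∏ r, (qFact (∑ t ∈ Finset.Iio r, f t) * qFact (∑ t ∈ Finset.Ioi r, f t)) := by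
  classical
  let G : ℕ → ℕ → K := fun r s => qFact (∑ t : Fin n with r ≤ t.val ∧ t.val < s, f t)
  have h := prod_interval_telescope G (fun _ _ => qFact_ne_zero _)
    (fun r => by
      simp only [G]
      rw [Finset.filter_false_of_mem, Finset.sum_empty, qFact_zero]
      intro t _; omega) n
  have e1 : ∀ r s : Fin n, r < s →
      qFact (f r + ∑ t ∈ Finset.Ioo r s, f t + f s) = G r (s + 1) := by
    intro r s hrs
    rw [← sum_Icc_eq f hrs]
    simp only [G]
    congr 2
    ext t
    simp only [Finset.mem_Icc, Finset.mem_filter, Finset.mem_univ, true_and, Fin.le_def]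
    omega
  have e2 : ∀ r s : Fin n, qFact (∑ t ∈ Finset.Ioo r s, f t) = G (r + 1) s := by
    intro r s
    simp only [G]
    congr 2
    ext t
    simp only [Finset.mem_Ioo, Finset.mem_filter, Finset.mem_univ, true_and, Fin.lt_def]
    omega
  have e3 : ∀ r : Fin n, qFact (f r) = G r (r + 1) := by
    intro r
    simp only [G]
    congr 1
    rw [Finset.sum_eq_single_of_mem r (by simp)]
    intro t ht htr
    simp only [Finset.mem_filter, Finset.mem_univ, true_and] at ht
    exact absurd (Fin.ext (by omega)) htr
  have e4 : qFact (∑ t, f t) = G 0 n := by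
    simp only [G]
    congr 2
    ext t; simp
  have e5 : ∀ r : Fin n, qFact (∑ t ∈ Finset.Iio r, f t) = G 0 r := by
    intro r
    simp only [G]
    congr 2
    ext t
    simp only [Finset.mem_Iio, Finset.mem_filter, Finset.mem_univ, true_and, Fin.lt_def]
    omega
  have e6 : ∀ r : Fin n, qFact (∑ t ∈ Finset.Ioi r, f t) = G (r + 1) n := by
    intro r
    simp only [G]
    congr 2
    ext t
    simp only [Finset.mem_Ioi, Finset.mem_filter, Finset.mem_univ, true_and, Fin.lt_def]
    omega
  have e7 : (∏ r, ∏ s ∈ Finset.Ioi r, qFact (f r + ∑ t ∈ Finset.Ioo r s, f t + f s) /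
      qFact (∑ t ∈ Finset.Ioo r s, f t)) =
      ∏ s ∈ Finset.range n, ∏ r ∈ Finset.range s, G r (s + 1) / G (r + 1) s := by
    rw [prod_Ioi_comm, Finset.prod_range]
    refine Finset.prod_congr rfl fun s _ => ?_
    rw [← prod_Iio_eq_prod_range (fun r => G r (s + 1) / G (r + 1) s) s]
    refine Finset.prod_congr rfl fun r hr => ?_
    rw [e1 r s (Finset.mem_Iio.1 hr), e2]
  rw [e7, e4]
  simp only [e3, e5, e6]
  rw [Finset.prod_range, Finset.prod_range, Finset.prod_range] at h
  rw [Finset.prod_range]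
  exact h

/-! ### Signs and powers of `q` -/

theorem prod_Ioi_neg_one_pow (f : Fin n → ℕ) :
    ∏ r, ∏ _s ∈ Finset.Ioi r, (-1 : K) ^ f r = ∏ s, (-1) ^ ∑ r ∈ Finset.Iio s, f r := by
  rw [prod_Ioi_comm]
  simp only [Finset.prod_pow_eq_pow_sum]

theorem two_mul_choose_two (x : ℕ) : (2 * x.choose 2 : ℤ) = x * (x - 1) := by
  induction x with
  | zero => simp
  | succ x ih =>
    rw [Nat.choose_succ_succ' x 1, Nat.choose_one_right]
    
    push_cast
    linarith

/-- Twice the comparison of powers of `q`, with `ι` marking inversions. Once the double sums are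
taken by the larger position `s`, the products `f r * f t` assemble to squares of the prefix sums
(`sum_Iio_sq`), and equality holds position by position. -/
theorem exponent_identity (f M D : Fin n → ℤ) (ι : Fin n → Fin n → ℤ) :
    ∑ r, ∑ s ∈ Finset.Ioi r, -(2 * (f r * (M s - M r - ι r s + (∑ t ∈ Finset.Iio s, f t -
        ∑ t ∈ Finset.Iio r, f t - f r))) + (f r + 1) * f r) +
      ∑ r, (2 * (M r + ∑ t ∈ Finset.Iio r, f t) *
          (∑ t ∈ Finset.Iio r, f t + ∑ t ∈ Finset.Ioi r, f t) -
        (M r + ∑ t ∈ Finset.Iio r, f t) * (M r + ∑ t ∈ Finset.Iio r, f t - 1) -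
        2 * (M r + ∑ t ∈ Finset.Iio r, f t) * (∑ t ∈ Finset.Ioi r, f t + D r - M r)) =
    ∑ r, ((M r + 1) * M r - 2 * M r * D r) +
      ∑ r, ∑ s ∈ Finset.Ioi r, 2 * f r * (M r + ι r s - D s) := by
  have h1 : ∑ r, ∑ s ∈ Finset.Ioi r, -(2 * (f r * (M s - M r - ι r s + (∑ t ∈ Finset.Iio s, f t -
        ∑ t ∈ Finset.Iio r, f t - f r))) + (f r + 1) * f r) -
      ∑ r, ∑ s ∈ Finset.Ioi r, 2 * f r * (M r + ι r s - D s) =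
      ∑ s, (2 * (∑ t ∈ Finset.Iio s, f t) * (D s - M s - ∑ t ∈ Finset.Iio s, f t) +
        (∑ t ∈ Finset.Iio s, f t) ^ 2 - ∑ t ∈ Finset.Iio s, f t) := by
    simp only [← Finset.sum_sub_distrib]
    rw [sum_Ioi_comm]
    refine Finset.sum_congr rfl fun s _ => ?_
    rw [← sum_Iio_sq, Finset.mul_sum, Finset.sum_mul, ← Finset.sum_add_distrib,
      ← Finset.sum_sub_distrib]
    refine Finset.sum_congr rfl fun r _ => ?_
    ring
  have h2 : ∑ s, (2 * (∑ t ∈ Finset.Iio s, f t) * (D s - M s - ∑ t ∈ Finset.Iio s, f t) +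
        (∑ t ∈ Finset.Iio s, f t) ^ 2 - ∑ t ∈ Finset.Iio s, f t) +
      ∑ r, (2 * (M r + ∑ t ∈ Finset.Iio r, f t) *
          (∑ t ∈ Finset.Iio r, f t + ∑ t ∈ Finset.Ioi r, f t) -
        (M r + ∑ t ∈ Finset.Iio r, f t) * (M r + ∑ t ∈ Finset.Iio r, f t - 1) -
        2 * (M r + ∑ t ∈ Finset.Iio r, f t) * (∑ t ∈ Finset.Ioi r, f t + D r - M r)) =
      ∑ r, ((M r + 1) * M r - 2 * M r * D r) := by
    rw [← Finset.sum_add_distrib]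
    refine Finset.sum_congr rfl fun r _ => ?_
    ring
  linarith

theorem neg_one_pow_mul_zpow_prod {ι' : Type*} (s : Finset ι') (k : ι' → ℕ) (e : ι' → ℤ)
    (f : ι' → K) :
    ∏ i ∈ s, ((-1) ^ k i * RatFunc.X ^ e i * f i) =
      (∏ i ∈ s, (-1) ^ k i) * RatFunc.X ^ (∑ i ∈ s, e i) * ∏ i ∈ s, f i := by
  rw [Finset.prod_mul_distrib, Finset.prod_mul_distrib,
    prod_zpow_eq_zpow_sum RatFunc.X_ne_zero]

theorem node_factor (k b w : ℕ) :
    (RatFunc.X : K) ^ ((k : ℤ) * w) / nodeWeight ((k + b : ℕ) : ℤ) k =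
      (-1) ^ k * RatFunc.X ^ ((k : ℤ) * w - k.choose 2 - k * b) * (qFact k * qFact b)⁻¹ := by
  have hX := RatFunc.X_ne_zero (K := ℚ)
  have h1 : ((-1 : K) ^ k)⁻¹ = (-1) ^ k := by rw [← inv_pow]; norm_num
  rw [nodeWeight_eq, div_eq_mul_inv, mul_assoc _ (qFact k), mul_inv, mul_inv, h1,
    ← zpow_natCast RatFunc.X (k.choose 2 + k * b), ← zpow_neg]
  have h2 : (k : ℤ) * w - k.choose 2 - k * b = k * w + -((k.choose 2 + k * b : ℕ) : ℤ) := by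
    push_cast; ring
  rw [h2, zpow_add₀ hX]
  ring

/-- The contribution of a lattice point in the grid to the interpolation formula. -/
theorem interpolation_term (a : Fin n → ℕ) (δ : Fin n → ℤ)
    (p : Equiv.Perm (Fin n) × (Fin n → ℕ)) (h : InGrid δ a (latticePoint a p)) :
    qDysonAt a (latticePoint a p) *
      ∏ i, (RatFunc.X ^ (latticePoint a p i * ((∑ j, (a j : ℤ)) - a i)) /
        nodeWeight ((∑ j, (a j : ℤ)) - a i + δ i) (latticePoint a p i)) =
    summandAt a δ p.1 p.2 * qMultinomial a := by
  obtain ⟨π, m⟩ := p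
  set f : Fin n → ℕ := fun t => a (π t) with hf
  set M : Fin n → ℕ := partialSum π m with hM
  set S : Fin n → ℕ := fun r => ∑ t ∈ Finset.Iio r, f t with hS
  set T : Fin n → ℕ := fun r => ∑ t ∈ Finset.Ioi r, f t with hT
  set B : Fin n → Fin n → ℕ := fun r s => ∑ t ∈ Finset.Ioo r s, f t with hB
  set c : Fin n → Fin n → ℕ := fun r s => (gap π m r s).toNat with hc
  have hα : ∀ r, latticePoint a (π, m) (π r) = ((M r + S r : ℕ) : ℤ) := by
    intro r; rw [latticePoint_apply a (π, m)]; simp [hS, hM, hf]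
  have hw : ∀ r, (∑ j, (a j : ℤ)) - a (π r) = ((S r + T r : ℕ) : ℤ) := by
    intro r
    rw [← Equiv.sum_comp π, sum_eq_Iio_add_Ioi _ r]
    simp only [hS, hT, hf]; push_cast; ring
  -- `b r` counts the nodes above the coordinate of `π r`; the grid hypothesis makes it
  -- non-negative.
  have hb : ∀ r, ∃ b : ℕ, (b : ℤ) = T r + δ (π r) - M r := by
    intro r
    have h1 := (latticePoint_le_iff δ a (π, m) r).1 (h (π r)).2
    refine ⟨((T r : ℤ) + δ (π r) - M r).toNat, Int.toNat_of_nonneg ?_⟩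
    simp only [hT, hM, hf]; push_cast; linarith
  choose b hb using hb
  have hd : ∀ r, (∑ j, (a j : ℤ)) - a (π r) + δ (π r) = ((M r + S r + b r : ℕ) : ℤ) := by
    intro r; rw [hw]; push_cast; rw [hb]; ring
  have hnode : ∏ i, (RatFunc.X ^ (latticePoint a (π, m) i * ((∑ j, (a j : ℤ)) - a i)) /
        nodeWeight ((∑ j, (a j : ℤ)) - a i + δ i) (latticePoint a (π, m) i)) =
      ∏ r, ((-1) ^ (M r + S r) * RatFunc.X ^ (((M r + S r : ℕ) : ℤ) * ((S r + T r : ℕ) : ℤ) -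
        ((M r + S r).choose 2 : ℕ) - ((M r + S r : ℕ) : ℤ) * (b r : ℕ)) *
        (qFact (M r + S r) * qFact (b r))⁻¹) := by
    rw [← Equiv.prod_comp π]
    refine Finset.prod_congr rfl fun r _ => ?_
    rw [hd, hw, hα, node_factor]
  have hpair : qDysonAt a (latticePoint a (π, m)) =
      (∏ s, (-1) ^ S s) * RatFunc.X ^ (∑ r, ∑ s ∈ Finset.Ioi r,
        (-((f r * (c r s + B r s) + (f r + 1).choose 2 : ℕ) : ℤ))) *
      ∏ r, ∏ s ∈ Finset.Ioi r, (qFact (f r + B r s + f s + c r s) / qFact (B r s + c r s)) := by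
    have hX : (RatFunc.X : K) ≠ 0 := RatFunc.X_ne_zero
    rw [← prod_Ioi_neg_one_pow, ← prod_zpow_eq_zpow_sum hX, ← Finset.prod_mul_distrib,
      ← Finset.prod_mul_distrib]
    simp only [← prod_zpow_eq_zpow_sum hX, ← Finset.prod_mul_distrib]
    exact qDysonAt_eq_prod_pair a (π, m)
  have hmono : ∏ r, ((-1) ^ M r * RatFunc.X ^ (((M r + 1).choose 2 : ℤ) - M r * δ (π r)) *
      ((RatFunc.X : K) ^ a (π r)) ^ zExponent δ π m r) =
      (∏ r, (-1) ^ M r) * RatFunc.X ^ (∑ r, (((M r + 1).choose 2 : ℤ) - M r * δ (π r) +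
        f r * zExponent δ π m r)) := by
    rw [← prod_zpow_eq_zpow_sum RatFunc.X_ne_zero, ← Finset.prod_mul_distrib]
    refine Finset.prod_congr rfl fun r _ => ?_
    rw [zpow_add₀ RatFunc.X_ne_zero, zpow_mul, zpow_natCast, mul_assoc]
  have hblocks : ∏ r, ∏ s ∈ Finset.Ioi r,
      (blockWith (RatFunc.X : K) (fun i => RatFunc.X ^ a i) π (Finset.Icc r s) (gap π m r s) /
        blockWith RatFunc.X (fun i => RatFunc.X ^ a i) π (Finset.Ioo r s) (gap π m r s)) =
      (∏ r, ∏ s ∈ Finset.Ioi r, (qFact (f r + B r s + f s + c r s) / qFact (B r s + c r s))) /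
        ∏ r, ∏ s ∈ Finset.Ioi r, (qFact (f r + B r s + f s) / qFact (B r s)) := by
    simp only [← Finset.prod_div_distrib]
    refine Finset.prod_congr rfl fun r _ => Finset.prod_congr rfl fun s hs => ?_
    have hrs := Finset.mem_Ioi.1 hs
    have hg : ((c r s : ℕ) : ℤ) = gap π m r s := Int.toNat_of_nonneg (gap_nonneg π m hrs)
    rw [blockWith_X_eq a π _ _ (f r + B r s + f s) (f r + B r s + f s + c r s)
        (sum_Icc_eq f hrs) (by rw [← hg]; push_cast; ring),
      blockWith_X_eq a π _ _ (B r s) (B r s + c r s) rfl (by rw [← hg]; push_cast; ring)]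
    exact div_div_div_comm _ _ _ _
  have hbottom : ∏ r, (blockWith (RatFunc.X : K) (fun i => RatFunc.X ^ a i) π (Finset.Iio r) (M r) *
      blockWith RatFunc.X (fun i => RatFunc.X ^ a i) π (Finset.Ioi r) (δ (π r) - M r)) =
      (∏ r, (qFact (M r + S r) * qFact (b r))) / ∏ r, (qFact (S r) * qFact (T r)) := by
    rw [← Finset.prod_div_distrib]
    refine Finset.prod_congr rfl fun r _ => ?_
    rw [blockWith_X_eq a π _ _ (S r) (M r + S r) rfl (by push_cast; ring),
      blockWith_X_eq a π _ _ (T r) (b r) rfl (by rw [hb]; ring)]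
    exact div_mul_div_comm _ _ _ _
  have hmult : qMultinomial a = qFact (∑ t, f t) / ∏ r, qFact (f r) := by
    rw [qMultinomial, ← Equiv.sum_comp π a,
      ← Equiv.prod_comp π (fun i => qPoch (RatFunc.X : K) RatFunc.X (a i))]
    rfl
  have htel := prod_qFact_telescope f
  have hsign : (∏ s, (-1 : K) ^ S s) * ∏ r, (-1) ^ (M r + S r) = ∏ r, (-1) ^ M r := by
    rw [← Finset.prod_mul_distrib]
    refine Finset.prod_congr rfl fun r _ => ?_
    rw [pow_add, mul_comm, mul_assoc, ← mul_pow]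
    norm_num
  have hexp : (∑ r, ∑ s ∈ Finset.Ioi r, (-((f r * (c r s + B r s) + (f r + 1).choose 2 : ℕ) : ℤ))) +
      ∑ r, (((M r + S r : ℕ) : ℤ) * ((S r + T r : ℕ) : ℤ) -
        ((M r + S r).choose 2 : ℕ) - ((M r + S r : ℕ) : ℤ) * (b r : ℕ)) =
      ∑ r, (((M r + 1).choose 2 : ℤ) - M r * δ (π r) + f r * zExponent δ π m r) := by
    have h1 := exponent_identity (fun r => (f r : ℤ)) (fun r => (M r : ℤ)) (fun r => δ (π r))
      (fun r s => if π s < π r then 1 else 0)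
    -- Doubling turns the binomial coefficients into products.
    apply mul_left_cancel₀ (two_ne_zero (α := ℤ))
    rw [mul_add, Finset.mul_sum, Finset.mul_sum, Finset.mul_sum]
    simp only [Finset.mul_sum]
    rw [← Finset.sum_add_distrib] at h1
    rw [← Finset.sum_add_distrib] at h1
    rw [← Finset.sum_add_distrib]
    convert h1 using 1
    · refine Finset.sum_congr rfl fun r _ => ?_
      congr 1
      · refine Finset.sum_congr rfl fun s hs => ?_
        have hrs := Finset.mem_Ioi.1 hs
        have hg : ((c r s : ℕ) : ℤ) = gap π m r s := Int.toNat_of_nonneg (gap_nonneg π m hrs)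
        have h2 := latticePoint_sub a (π, m) hrs
        rw [latticePoint_apply, latticePoint_apply] at h2
        have h3 := two_mul_choose_two (f r + 1)
        have h4 : (B r s : ℤ) = ∑ t ∈ Finset.Iio s, (f t : ℤ) - ∑ t ∈ Finset.Iio r, (f t : ℤ) -
            f r := by
          simp only [gap] at h2
          simp only [hB, hf]
          linarith
        push_cast at h3 ⊢
        rw [h4, hg, gap]
        linarith
      · have h3 := two_mul_choose_two (M r + S r)
        have h4 : (S r : ℤ) = ∑ t ∈ Finset.Iio r, (f t : ℤ) := by simp [hS]
        have h5 : (T r : ℤ) = ∑ t ∈ Finset.Ioi r, (f t : ℤ) := by simp [hT]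
        rw [← h4, ← h5, hb]
        push_cast at h3 ⊢
        linarith
    · refine Finset.sum_congr rfl fun r _ => ?_
      have h3 := two_mul_choose_two (M r + 1)
      have h6 : ∑ s ∈ Finset.Ioi r, 2 * (f r : ℤ) * ((M r : ℤ) + (if π s < π r then 1 else 0) -
          δ (π s)) = 2 * f r * zExponent δ π m r := by
        rw [← Finset.mul_sum]; rfl
      rw [h6]
      push_cast at h3
      linarith
  rw [hnode, hpair, summandAt, summandWith, hmono, hblocks, hbottom, hmult,
    neg_one_pow_mul_zpow_prod, ← hexp, zpow_add₀ RatFunc.X_ne_zero, ← hsign, Finset.prod_inv_distrib]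
  have n1 : ∏ r, (qFact (M r + S r) * qFact (b r)) ≠ 0 :=
    Finset.prod_ne_zero_iff.2 fun _ _ => mul_ne_zero (qFact_ne_zero _) (qFact_ne_zero _)
  have n2 : ∏ r, (qFact (S r) * qFact (T r)) ≠ 0 :=
    Finset.prod_ne_zero_iff.2 fun _ _ => mul_ne_zero (qFact_ne_zero _) (qFact_ne_zero _)
  have n3 : ∏ r, qFact (f r) ≠ 0 := Finset.prod_ne_zero_iff.2 fun _ _ => qFact_ne_zero _
  have n4 : ∏ r, ∏ s ∈ Finset.Ioi r, (qFact (f r + B r s + f s) / qFact (B r s)) ≠ 0 :=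
    Finset.prod_ne_zero_iff.2 fun _ _ => Finset.prod_ne_zero_iff.2 fun _ _ =>
      div_ne_zero (qFact_ne_zero _) (qFact_ne_zero _)
  -- Telescoping replaces the numerator of the multinomial coefficient; its `∏ (q)_{f r}` then
  -- cancels the denominator, and the remaining factors match those of the blocks.
  have htel' : qFact (∑ t, f t) = (∏ r, ∏ s ∈ Finset.Ioi r,
      (qFact (f r + B r s + f s) / qFact (B r s))) * (∏ r, qFact (f r)) /
        ∏ r, (qFact (S r) * qFact (T r)) := by
    rw [eq_div_iff n2]; exact htel.symm
  rw [htel']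
  generalize (∏ r, ∏ s ∈ Finset.Ioi r, (qFact (f r + B r s + f s) / qFact (B r s))) = x at *
  generalize (∏ r, qFact (f r)) = y at *
  generalize (∏ r, (qFact (S r) * qFact (T r))) = z at *
  generalize (∏ r, (qFact (M r + S r) * qFact (b r))) = w at *
  field_simp

/-- The coefficient formula at each `a`, as a sum over the feasible pairs. -/
theorem coeff_qDyson_eq_sum_summandAt (a : Fin n → ℕ) {δ : Fin n → ℤ} (hδ : ∑ i, δ i = 0) :
    (qDyson a).coeff δ = (∑ p ∈ feasiblePairs δ, summandAt a δ p.1 p.2) * qMultinomial a := by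
  classical
  rw [coeff_qDyson_eq_sum a hδ, Finset.sum_mul]
  have h1 : ∀ p ∈ feasiblePairs δ, p ∉ (feasiblePairs δ).filter
      (fun p => InGrid δ a (latticePoint a p)) → summandAt a δ p.1 p.2 * qMultinomial a = 0 := by
    intro p hp hp'
    rw [summandAt_eq_zero, zero_mul]
    exact fun h => hp' (Finset.mem_filter.2 ⟨hp, h⟩)
  rw [← Finset.sum_subset (Finset.filter_subset _ _) h1]
  have h2 : ((feasiblePairs δ).filter (fun p => InGrid δ a (latticePoint a p))).image
      (latticePoint a) ⊆ grid δ a := by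
    intro α hα
    obtain ⟨p, hp, rfl⟩ := Finset.mem_image.1 hα
    exact (mem_grid δ a _).2 (Finset.mem_filter.1 hp).2
  rw [← Finset.sum_subset h2, Finset.sum_image ((latticePoint_injective a).injOn)]
  · exact Finset.sum_congr rfl fun p hp => interpolation_term a δ p (Finset.mem_filter.1 hp).2
  · intro α hα hα'
    have hg := (mem_grid δ a α).1 hα
    by_contra hne
    obtain ⟨p, hp, rfl⟩ := (qDysonAt_ne_zero_iff_exists δ a α hg).1 (left_ne_zero_of_mul hne)
    exact hα' (Finset.mem_image.2 ⟨p, Finset.mem_filter.2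
      ⟨(mem_feasiblePairs δ p).2 hp, hg⟩, rfl⟩)

/-! ### Rational functions with denominators that do not vanish at `z_i = q^{a_i}` -/

/-- The products of a monomial and of factors `1 - q^L` with `L` of positive constant term. -/
def denominators (n : ℕ) : Submonoid (Poly n) where
  carrier := {D | ∃ (μ : Option (Fin n) →₀ ℕ) (Ls : Multiset (AffineForm n)),
    (∀ L ∈ Ls, 1 ≤ L.const) ∧ D = MvPolynomial.monomial μ 1 * (Ls.map oneSubQPow).prod}
  one_mem' := ⟨0, 0, by simp, by simp⟩
  mul_mem' := by
    rintro _ _ ⟨μ, Ls, h, rfl⟩ ⟨ν, Ls', h', rfl⟩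
    refine ⟨μ + ν, Ls + Ls', ?_, ?_⟩
    · intro L hL
      rcases Multiset.mem_add.1 hL with hL | hL
      · exact h L hL
      · exact h' L hL
    · rw [Multiset.map_add, Multiset.prod_add, ← one_mul (1 : ℚ), ← MvPolynomial.monomial_mul]
      simp only [one_mul]
      ring

theorem X_mem_denominators (o : Option (Fin n)) : MvPolynomial.X o ∈ denominators n :=
  ⟨Finsupp.single o 1, 0, by simp, by simp [MvPolynomial.X]⟩

theorem oneSubQPow_mem_denominators (L : AffineForm n) (h : 1 ≤ L.const) :
    oneSubQPow L ∈ denominators n :=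
  ⟨0, {L}, by simpa using h, by simp⟩

theorem evalAt_oneSubQPow (a : Fin n → ℕ) (L : AffineForm n) :
    evalAt a (oneSubQPow L) = 1 - RatFunc.X ^ (L.const + ∑ i, a i * L.coeff i) := by
  simp [evalAt, oneSubQPow, map_prod, pow_add, ← Finset.prod_pow_eq_pow_sum, pow_mul]

theorem evalAt_prod_oneSubQPow_ne_zero (a : Fin n → ℕ) (Ls : Multiset (AffineForm n))
    (h : ∀ L ∈ Ls, 1 ≤ L.const) : evalAt a (Ls.map oneSubQPow).prod ≠ 0 := by
  rw [map_multiset_prod, Multiset.map_map]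
  apply Multiset.prod_ne_zero
  simp only [Multiset.mem_map, Function.comp, not_exists, not_and]
  intro L hL
  rw [evalAt_oneSubQPow]
  exact one_sub_X_pow_ne_zero (by have := h L hL; omega)

theorem evalAt_X_ne_zero (a : Fin n → ℕ) (o : Option (Fin n)) :
    evalAt a (MvPolynomial.X o) ≠ 0 := by
  cases o <;> simp [evalAt, RatFunc.X_ne_zero]

theorem evalAt_monomial_ne_zero (a : Fin n → ℕ) (μ : Option (Fin n) →₀ ℕ) :
    evalAt a (MvPolynomial.monomial μ 1) ≠ 0 := by
  rw [MvPolynomial.monomial_eq, map_mul, map_one, map_one, one_mul, Finsupp.prod, map_prod,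
    Finset.prod_ne_zero_iff]
  intro o _
  rw [map_pow]
  exact pow_ne_zero _ (evalAt_X_ne_zero a o)

theorem evalAt_ne_zero_of_mem (a : Fin n → ℕ) {D : Poly n} (h : D ∈ denominators n) :
    evalAt a D ≠ 0 := by
  obtain ⟨μ, Ls, h, rfl⟩ := h
  rw [map_mul]
  exact mul_ne_zero (evalAt_monomial_ne_zero a μ) (evalAt_prod_oneSubQPow_ne_zero a Ls h)

theorem algebraMap_ne_zero_of_mem {D : Poly n} (h : D ∈ denominators n) :
    algebraMap (Poly n) (Rat n) D ≠ 0 := by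
  intro h0
  have h1 : D = 0 := (IsFractionRing.injective (Poly n) (Rat n)) (by rw [h0, map_zero])
  apply evalAt_ne_zero_of_mem 0 h
  rw [h1, map_zero]

/-- `f` is a quotient `P / D` with `D` in `denominators n`, and `v a` is its value at
`z_i = q^{a_i}`. -/
def HasValue (f : Rat n) (v : (Fin n → ℕ) → K) : Prop :=
  ∃ P D : Poly n, D ∈ denominators n ∧
    f * algebraMap (Poly n) (Rat n) D = algebraMap (Poly n) (Rat n) P ∧
      ∀ a, v a * evalAt a D = evalAt a P

theorem HasValue.mul {f g : Rat n} {v w : (Fin n → ℕ) → K} (hf : HasValue f v)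
    (hg : HasValue g w) : HasValue (f * g) (fun a => v a * w a) := by
  obtain ⟨P, D, hD, h1, h2⟩ := hf
  obtain ⟨P', D', hD', h1', h2'⟩ := hg
  refine ⟨P * P', D * D', mul_mem hD hD', ?_, fun a => ?_⟩
  · rw [map_mul, map_mul, ← h1, ← h1']; ring
  · rw [map_mul, map_mul, ← h2, ← h2']; ring

theorem HasValue.add {f g : Rat n} {v w : (Fin n → ℕ) → K} (hf : HasValue f v)
    (hg : HasValue g w) : HasValue (f + g) (fun a => v a + w a) := by
  obtain ⟨P, D, hD, h1, h2⟩ := hf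
  obtain ⟨P', D', hD', h1', h2'⟩ := hg
  refine ⟨P * D' + P' * D, D * D', mul_mem hD hD', ?_, fun a => ?_⟩
  · rw [map_mul, map_add, map_mul, map_mul, ← h1, ← h1']; ring
  · rw [map_mul, map_add, map_mul, map_mul, ← h2, ← h2']; ring

theorem HasValue.ofPoly (P : Poly n) :
    HasValue (algebraMap (Poly n) (Rat n) P) (fun a => evalAt a P) :=
  ⟨P, 1, one_mem _, by simp, by simp⟩

theorem HasValue.inv_ofPoly {D : Poly n} (h : D ∈ denominators n) :
    HasValue (algebraMap (Poly n) (Rat n) D)⁻¹ (fun a => (evalAt a D)⁻¹) :=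
  ⟨1, D, h, by rw [inv_mul_cancel₀ (algebraMap_ne_zero_of_mem h), map_one],
    fun a => by rw [inv_mul_cancel₀ (evalAt_ne_zero_of_mem a h), map_one]⟩

theorem HasValue.zero : HasValue (0 : Rat n) (fun _ => 0) := by
  simpa using HasValue.ofPoly (0 : Poly n)

theorem HasValue.one : HasValue (1 : Rat n) (fun _ => 1) := by
  simpa using HasValue.ofPoly (1 : Poly n)

theorem HasValue.neg_one : HasValue (-1 : Rat n) (fun _ => -1) := by
  simpa using HasValue.ofPoly (-1 : Poly n)

theorem HasValue.sum {ι : Type*} (s : Finset ι) {f : ι → Rat n} {v : ι → (Fin n → ℕ) → K}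
    (h : ∀ i ∈ s, HasValue (f i) (v i)) :
    HasValue (∑ i ∈ s, f i) (fun a => ∑ i ∈ s, v i a) := by
  classical
  induction s using Finset.induction_on with
  | empty => simpa using HasValue.zero
  | insert i s hi ih =>
    simp only [Finset.sum_insert hi]
    exact (h i (by simp)).add (ih fun j hj => h j (by simp [hj]))

theorem HasValue.prod {ι : Type*} (s : Finset ι) {f : ι → Rat n} {v : ι → (Fin n → ℕ) → K}
    (h : ∀ i ∈ s, HasValue (f i) (v i)) :
    HasValue (∏ i ∈ s, f i) (fun a => ∏ i ∈ s, v i a) := by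
  classical
  induction s using Finset.induction_on with
  | empty => simpa using HasValue.one
  | insert i s hi ih =>
    simp only [Finset.prod_insert hi]
    exact (h i (by simp)).mul (ih fun j hj => h j (by simp [hj]))

theorem HasValue.pow {f : Rat n} {v : (Fin n → ℕ) → K} (h : HasValue f v) (k : ℕ) :
    HasValue (f ^ k) (fun a => v a ^ k) := by
  simpa using HasValue.prod (Finset.range k) (fun _ _ => h)

theorem HasValue.zpow {f : Rat n} {v : (Fin n → ℕ) → K} (h : HasValue f v)
    (h' : HasValue f⁻¹ (fun a => (v a)⁻¹)) (k : ℤ) : HasValue (f ^ k) (fun a => v a ^ k) := by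
  rcases Int.eq_nat_or_neg k with ⟨k, rfl | rfl⟩
  · simpa using h.pow k
  · simpa using h'.pow k

theorem HasValue.q : HasValue (qGen n) (fun _ => RatFunc.X) := by
  simpa [evalAt, qGen] using HasValue.ofPoly (MvPolynomial.X none : Poly n)

theorem HasValue.q_inv : HasValue (qGen n)⁻¹ (fun _ => RatFunc.X⁻¹) := by
  simpa [evalAt, qGen] using HasValue.inv_ofPoly (X_mem_denominators (n := n) none)

theorem HasValue.z (i : Fin n) : HasValue (zGen i) (fun a => RatFunc.X ^ a i) := by
  simpa [evalAt, zGen] using HasValue.ofPoly (MvPolynomial.X (some i) : Poly n)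

theorem HasValue.z_inv (i : Fin n) :
    HasValue (zGen i)⁻¹ (fun a => (RatFunc.X ^ a i)⁻¹) := by
  simpa [evalAt, zGen] using HasValue.inv_ofPoly (X_mem_denominators (n := n) (some i))

/-- The form `t + 1 + ∑_{s ∈ I} a_{π(s)}`. -/
def blockForm (π : Equiv.Perm (Fin n)) (I : Finset (Fin n)) (t : ℕ) : AffineForm n where
  const := t + 1
  coeff i := if π.symm i ∈ I then 1 else 0

theorem prod_pow_coeff_blockForm {F : Type*} [CommMonoid F] (z : Fin n → F)
    (π : Equiv.Perm (Fin n)) (I : Finset (Fin n)) (t : ℕ) :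
    ∏ i, z i ^ (blockForm π I t).coeff i = ∏ s ∈ I, z (π s) := by
  rw [← Equiv.prod_comp π]
  simp [blockForm, Finset.prod_ite_mem]

theorem algebraMap_oneSubQPow_blockForm (π : Equiv.Perm (Fin n)) (I : Finset (Fin n)) (t : ℕ) :
    algebraMap (Poly n) (Rat n) (oneSubQPow (blockForm π I t)) =
      1 - qGen n ^ t * (qGen n * ∏ s ∈ I, zGen (π s)) := by
  rw [oneSubQPow, prod_pow_coeff_blockForm (fun i => (MvPolynomial.X (some i) : Poly n))]
  simp only [map_sub, map_one, map_mul, map_pow, map_prod, qGen, zGen, blockForm, pow_succ,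
    mul_assoc]

theorem evalAt_oneSubQPow_blockForm (a : Fin n → ℕ) (π : Equiv.Perm (Fin n))
    (I : Finset (Fin n)) (t : ℕ) :
    evalAt a (oneSubQPow (blockForm π I t)) =
      1 - RatFunc.X ^ t * (RatFunc.X * ∏ s ∈ I, RatFunc.X ^ a (π s)) := by
  rw [oneSubQPow, prod_pow_coeff_blockForm (fun i => (MvPolynomial.X (some i) : Poly n))]
  simp only [map_sub, map_one, map_mul, map_pow, map_prod, evalAt, MvPolynomial.aeval_X, blockForm,
    pow_succ, mul_assoc, Option.elim]

theorem HasValue.block (π : Equiv.Perm (Fin n)) (I : Finset (Fin n)) {c : ℤ} (hc : 0 ≤ c) :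
    HasValue (blockWith (qGen n) zGen π I c)
      (fun a => blockWith RatFunc.X (fun i => RatFunc.X ^ a i) π I c) := by
  simp only [blockWith, qPochInt, if_pos hc, qPoch, ← algebraMap_oneSubQPow_blockForm,
    ← evalAt_oneSubQPow_blockForm]
  exact HasValue.prod _ fun t _ => HasValue.ofPoly _

/-- For negative `c` the reciprocal is a polynomial in `q⁻¹`, `q` and the `z_i`, so it adds only
powers of `q` to the denominator and may vanish at `z_i = q^{a_i}`. -/
theorem HasValue.block_inv (π : Equiv.Perm (Fin n)) (I : Finset (Fin n)) (c : ℤ) :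
    HasValue (blockWith (qGen n) zGen π I c)⁻¹
      (fun a => (blockWith RatFunc.X (fun i => RatFunc.X ^ a i) π I c)⁻¹) := by
  by_cases hc : 0 ≤ c
  · simp only [blockWith, qPochInt, if_pos hc, qPoch, ← algebraMap_oneSubQPow_blockForm,
      ← evalAt_oneSubQPow_blockForm, ← Finset.prod_inv_distrib]
    exact HasValue.prod _ fun t _ => HasValue.inv_ofPoly
      (oneSubQPow_mem_denominators (blockForm π I t) (Nat.le_add_left 1 t))
  · simp only [blockWith, qPochInt, if_neg hc, inv_inv, sub_eq_add_neg, ← neg_one_mul (_ * _),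
      ← inv_pow]
    exact HasValue.prod _ fun t _ => HasValue.one.add (HasValue.neg_one.mul
      ((HasValue.q_inv.pow t).mul (HasValue.q.mul
        (HasValue.prod _ fun s _ => HasValue.z _))))

theorem HasValue.summand (δ : Fin n → ℤ) (π : Equiv.Perm (Fin n)) (m : Fin n → ℕ) :
    HasValue (summand δ π m) (fun a => summandAt a δ π m) := by
  simp only [summand_eq_summandWith, summandAt, summandWith, div_eq_mul_inv,
    ← Finset.prod_inv_distrib, mul_inv]
  refine HasValue.mul (HasValue.mul (HasValue.prod _ fun r _ => ?_) (HasValue.prod _ fun r _ =>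
    HasValue.prod _ fun s hs => ?_)) (HasValue.prod _ fun r _ => ?_)
  · exact ((HasValue.neg_one.pow _).mul (HasValue.q.zpow HasValue.q_inv _)).mul
      ((HasValue.z _).zpow (HasValue.z_inv _) _)
  · exact (HasValue.block _ _ (gap_nonneg π m (Finset.mem_Ioi.1 hs))).mul
      (HasValue.block_inv _ _ _)
  · exact (HasValue.block_inv _ _ _).mul (HasValue.block_inv _ _ _)

theorem HasValue.R (δ : Fin n → ℤ) :
    HasValue (R δ) (fun a => ∑ p ∈ feasiblePairs δ, summandAt a δ p.1 p.2) :=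
  HasValue.sum _ fun p _ => HasValue.summand δ p.1 p.2

/-! ### The case `δ = 0` -/

theorem descents_one : descents (1 : Equiv.Perm (Fin n)) = ∅ := by
  ext t
  simp only [descents, Finset.mem_filter, Finset.mem_univ, true_and, Equiv.Perm.coe_one, id,
    Finset.notMem_empty, iff_false, not_exists, Fin.lt_def]
  intro h; omega

/-- Feasibility bounds the last partial sum by zero; by monotonicity all of them vanish, leaving no
inversions and no `m`. -/
theorem feasible_zero_iff (p : Equiv.Perm (Fin n) × (Fin n → ℕ)) :
    Feasible 0 p.1 p.2 ↔ p = (1, 0) := by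
  constructor
  · intro h
    have h1 : ∀ r, partialSum p.1 p.2 r = 0 := by
      intro r
      have hn := r.pos
      have h2 := h ⟨n - 1, by omega⟩ (by simp; omega)
      have h3 := partialSum_mono p.1 p.2 (show r ≤ ⟨n - 1, by omega⟩ by
        simp only [Fin.le_def]; omega)
      rw [partialSum_last _ _ ⟨n - 1, by omega⟩ (by simp; omega)] at h3
      simp only [Pi.zero_apply] at h2
      zify at h3 ⊢
      have : (0 : ℤ) ≤ partialSum p.1 p.2 r := by positivity
      linarith
    have h2 : StrictMono p.1 := by
      intro r s hrs
      have h3 := partialSum_add_le p.1 p.2 hrs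
      rw [h1, h1] at h3
      split_ifs at h3 with c
      · omega
      · exact lt_of_le_of_ne (not_lt.1 c) fun e => hrs.ne (p.1.injective e)
    have h3 : p.1 = 1 := by
      ext1 r
      have h4 : (p.1 : Fin n → Fin n) = id := by
        rw [← h2.range_inj strictMono_id, p.1.surjective.range_eq, Set.range_id]
      exact congrFun h4 r
    have h4 : p.2 = 0 := by
      funext r
      have h5 := h1 r
      rw [partialSum, add_eq_zero, Finset.sum_eq_zero_iff] at h5
      exact h5.1 r (by simp)
    exact Prod.ext h3 h4
  · rintro rfl l hl
    simp [des, descents_one]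

theorem summandAt_zero (a : Fin n → ℕ) : summandAt a 0 (1 : Equiv.Perm (Fin n)) 0 = 1 := by
  have h2 : ∀ r, partialSum (1 : Equiv.Perm (Fin n)) 0 r = 0 := by
    intro r; simp [partialSum, descents_one]
  have h3 : ∀ r s : Fin n, r < s → gap (1 : Equiv.Perm (Fin n)) 0 r s = 0 := by
    intro r s h; simp [gap, h2, h.not_gt]
  have h4 : ∀ r, zExponent 0 (1 : Equiv.Perm (Fin n)) 0 r = 0 := by
    intro r
    refine Finset.sum_eq_zero fun s hs => ?_
    simp [h2, (Finset.mem_Ioi.1 hs).not_gt]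
  have h5 : ∀ I, blockWith (RatFunc.X : K) (fun i => RatFunc.X ^ a i) 1 I 0 = 1 := by
    intro I; simp [blockWith, qPochInt, qPoch]
  have h6 : ∏ r, ∏ s ∈ Finset.Ioi r, (blockWith (RatFunc.X : K) (fun i => RatFunc.X ^ a i) 1
      (Finset.Icc r s) (gap 1 0 r s) / blockWith (RatFunc.X : K) (fun i => RatFunc.X ^ a i) 1
      (Finset.Ioo r s) (gap 1 0 r s)) = 1 := by
    refine Finset.prod_eq_one fun r _ => Finset.prod_eq_one fun s hs => ?_
    rw [h3 r s (Finset.mem_Ioi.1 hs), h5, h5, div_one]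
  rw [summandAt, summandWith, h6]
  simp [h2, h4, h5]

/-- The `q`-Dyson theorem of Zeilberger and Bressoud. -/
theorem coeff_zero_qDyson (a : Fin n → ℕ) : (qDyson a).coeff 0 = qMultinomial a := by
  have h : feasiblePairs (0 : Fin n → ℤ) = {(1, 0)} := by
    ext p
    rw [mem_feasiblePairs, feasible_zero_iff, Finset.mem_singleton]
  rw [coeff_qDyson_eq_sum_summandAt a (by simp), h, Finset.sum_singleton, summandAt_zero, one_mul]

/-! ### Substituting powers of `q` into multivariate power series -/

section Series

variable {σ A : Type*} [Fintype σ] [CommRing A]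

theorem hasSubst_X_pow (w : σ → ℕ) (hw : ∀ s, w s ≠ 0) :
    MvPowerSeries.HasSubst (fun s => (PowerSeries.X : PowerSeries A) ^ w s) :=
  MvPowerSeries.hasSubst_of_constantCoeff_zero fun s => by
    change PowerSeries.constantCoeff (PowerSeries.X ^ w s) = 0
    simp [hw s]

/-- The substitution `s ↦ X ^ w s` with positive exponents `w s`. -/
noncomputable def evalSeries (A : Type*) [CommRing A] (w : σ → ℕ) (hw : ∀ s, w s ≠ 0) :
    MvPowerSeries σ A →ₐ[A] PowerSeries A :=
  MvPowerSeries.substAlgHom (hasSubst_X_pow w hw)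

theorem evalSeries_X (w : σ → ℕ) (hw : ∀ s, w s ≠ 0) (s : σ) :
    evalSeries A w hw (MvPowerSeries.X s) = PowerSeries.X ^ w s :=
  MvPowerSeries.substAlgHom_X _ s

theorem evalSeries_C (w : σ → ℕ) (hw : ∀ s, w s ≠ 0) (y : A) :
    evalSeries A w hw (MvPowerSeries.C y) = PowerSeries.C y :=
  (evalSeries A w hw).commutes y

theorem evalSeries_coe (w : σ → ℕ) (hw : ∀ s, w s ≠ 0) (P : MvPolynomial σ A) :
    evalSeries A w hw (P : MvPowerSeries σ A) =
      MvPolynomial.aeval (fun s => (PowerSeries.X : PowerSeries A) ^ w s) P :=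
  MvPowerSeries.substAlgHom_coe _ P

theorem coeff_prod_X_pow (w : σ → ℕ) (d : σ →₀ ℕ) (k : ℕ) :
    PowerSeries.coeff k (d.prod fun s e => ((PowerSeries.X : PowerSeries A) ^ w s) ^ e) =
      if k = ∑ s, w s * d s then 1 else 0 := by
  rw [Finsupp.prod_fintype _ _ (by simp)]
  simp only [← pow_mul]
  rw [Finset.prod_pow_eq_pow_sum, PowerSeries.coeff_X_pow]

theorem finite_weight_eq (w : σ → ℕ) (hw : ∀ s, w s ≠ 0) (k : ℕ) :
    {d : σ →₀ ℕ | k = ∑ s, w s * d s}.Finite := by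
  classical
  refine (Set.finite_Icc 0 (Finsupp.equivFunOnFinite.symm fun _ : σ => k)).subset ?_
  refine fun d hd => ⟨zero_le, fun s => ?_⟩
  rw [Set.mem_ofPred_eq] at hd
  rw [Finsupp.equivFunOnFinite_symm_apply_apply, hd]
  calc d s ≤ w s * d s := Nat.le_mul_of_pos_left _ (Nat.pos_of_ne_zero (hw s))
    _ ≤ _ := Finset.single_le_sum (f := fun s => w s * d s) (fun _ _ => Nat.zero_le _)
      (Finset.mem_univ s)

/-- Positive weights leave only finitely many exponents of each total weight, so evaluation is a
finite sum in each degree. -/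
theorem coeff_evalSeries (w : σ → ℕ) (hw : ∀ s, w s ≠ 0) (f : MvPowerSeries σ A) (k : ℕ) :
    PowerSeries.coeff k (evalSeries A w hw f) =
      ∑ d ∈ (finite_weight_eq w hw k).toFinset, MvPowerSeries.coeff d f := by
  have h := MvPowerSeries.coeff_subst (hasSubst_X_pow (A := A) w hw) f (Finsupp.single () k)
  rw [evalSeries, MvPowerSeries.substAlgHom_apply]
  refine h.trans ?_
  have h1 : ∀ d : σ →₀ ℕ, MvPowerSeries.coeff d f • (MvPowerSeries.coeff (Finsupp.single () k))
      (d.prod fun s e => ((PowerSeries.X : PowerSeries A) ^ w s) ^ e) =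
      if k = ∑ s, w s * d s then MvPowerSeries.coeff d f else 0 := by
    intro d
    have h2 := coeff_prod_X_pow (A := A) w d k
    rw [PowerSeries.coeff] at h2
    rw [h2]
    split_ifs <;> simp
  simp only [h1]
  rw [finsum_eq_sum_of_support_subset _ (s := (finite_weight_eq w hw k).toFinset)]
  · refine Finset.sum_congr rfl fun d hd => if_pos ?_
    simpa using hd
  · intro d hd
    simp only [Function.mem_support, ne_eq, ite_eq_right_iff, not_forall] at hd
    simpa using hd.1

theorem constantCoeff_evalSeries (w : σ → ℕ) (hw : ∀ s, w s ≠ 0) (f : MvPowerSeries σ A) :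
    PowerSeries.constantCoeff (evalSeries A w hw f) = MvPowerSeries.constantCoeff f := by
  rw [← PowerSeries.coeff_zero_eq_constantCoeff_apply, coeff_evalSeries,
    ← MvPowerSeries.coeff_zero_eq_constantCoeff_apply, Finset.sum_eq_single 0]
  · intro d hd hd0
    refine absurd (Finsupp.ext fun s => ?_) hd0
    simp only [Set.Finite.mem_toFinset, Set.mem_ofPred_eq] at hd
    have := (Finset.sum_eq_zero_iff.1 hd.symm) s (Finset.mem_univ s)
    simpa [hw s] using this
  · intro h; simp at h

end Series

/-- Reading exponents as digits in base `N`, only the smaller vector `u` needs to be bounded: its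
tail weighs less than one unit of the digit `i`, and the tail of `v` only helps. -/
theorem sum_mul_pow_lt_of_lex {u v : Fin n → ℕ} {N : ℕ} (hN : ∑ k, u k < N) (i : Fin n)
    (h1 : ∀ j < i, u j = v j) (h2 : u i < v i) :
    ∑ k, N ^ (n - 1 - k.val) * u k < ∑ k, N ^ (n - 1 - k.val) * v k := by
  have hN0 : 0 < N := by omega
  have h3 : ∑ k ∈ Finset.Ioi i, N ^ (n - 1 - k.val) * u k < N ^ (n - 1 - i.val) := by
    refine lt_of_mul_lt_mul_left (a := N) ?_ hN0.le
    rw [Finset.mul_sum]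
    calc ∑ k ∈ Finset.Ioi i, N * (N ^ (n - 1 - k.val) * u k)
        ≤ ∑ k ∈ Finset.Ioi i, N ^ (n - 1 - i.val) * u k := by
          refine Finset.sum_le_sum fun k hk => ?_
          rw [← mul_assoc, ← pow_succ']
          refine Nat.mul_le_mul_right _ (Nat.pow_le_pow_right hN0 ?_)
          have := Fin.lt_def.1 (Finset.mem_Ioi.1 hk)
          omega
      _ ≤ N ^ (n - 1 - i.val) * ∑ k, u k := by
          rw [← Finset.mul_sum]
          exact Nat.mul_le_mul_left _ (Finset.sum_le_sum_of_subset (Finset.subset_univ _))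
      _ < N ^ (n - 1 - i.val) * N := Nat.mul_lt_mul_of_pos_left hN (pow_pos hN0 _)
      _ = N * N ^ (n - 1 - i.val) := mul_comm _ _
  zify at h3 ⊢
  rw [sum_eq_Iio_add_Ioi _ i, sum_eq_Iio_add_Ioi (fun k => (N : ℤ) ^ (n - 1 - k.val) * (v k : ℤ)) i]
  have h4 : ∑ k ∈ Finset.Iio i, (N : ℤ) ^ (n - 1 - k.val) * (u k : ℤ) =
      ∑ k ∈ Finset.Iio i, (N : ℤ) ^ (n - 1 - k.val) * (v k : ℤ) :=
    Finset.sum_congr rfl fun k hk => by rw [h1 k (Finset.mem_Iio.1 hk)]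
  have h5 : (0 : ℤ) ≤ ∑ k ∈ Finset.Ioi i, (N : ℤ) ^ (n - 1 - k.val) * (v k : ℤ) := by positivity
  have h6 : (N : ℤ) ^ (n - 1 - i.val) * ((u i : ℤ) + 1) ≤ (N : ℤ) ^ (n - 1 - i.val) * (v i : ℤ) :=
    mul_le_mul_of_nonneg_left (by exact_mod_cast h2) (by positivity)
  rw [h4]
  linarith

/-- The exponents of the substitution `q ↦ q`, `z_i ↦ q^{a_i}`. -/
def seriesWeight (a : Fin n → ℕ) (o : Option (Fin n)) : ℕ := o.elim 1 a

theorem seriesWeight_ne_zero {a : Fin n → ℕ} (ha : ∀ i, a i ≠ 0) (o : Option (Fin n)) :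
    seriesWeight a o ≠ 0 := by
  cases o <;> simp [seriesWeight, ha]

/-- A power series in `q, z_1, …, z_n` is determined by its values at `z_i = q^{a_i}`. -/
theorem eq_zero_of_evalSeries_eq_zero {A : Type*} [CommRing A]
    (f : MvPowerSeries (Option (Fin n)) A)
    (h : ∀ (a : Fin n → ℕ) (ha : ∀ i, a i ≠ 0),
      evalSeries A (seriesWeight a) (seriesWeight_ne_zero ha) f = 0) : f = 0 := by
  by_contra hf
  let e : Fin (n + 1) ≃ Option (Fin n) := finSuccEquivLast
  let key : (Option (Fin n) →₀ ℕ) → Lex (Fin (n + 1) → ℕ) := fun d => toLex fun k => d (e k)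
  obtain ⟨d₀, hd₀⟩ : ∃ d, MvPowerSeries.coeff d f ≠ 0 := by
    by_contra! hc
    exact hf (MvPowerSeries.ext hc)
  -- Take the lexicographically least exponent in the support, with `q` as last variable. Weights
  -- that are powers of a base exceeding its total degree make it the only exponent of the support
  -- with its weight, so its coefficient survives evaluation.
  obtain ⟨d, hd, hmin⟩ := (InvImage.wf key wellFounded_lt).has_min
    {d | MvPowerSeries.coeff d f ≠ 0} ⟨d₀, hd₀⟩
  let N : ℕ := ∑ k, d (e k) + 1
  let a : Fin n → ℕ := fun i => N ^ (n - i.val)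
  have ha : ∀ i, a i ≠ 0 := fun i => pow_ne_zero _ (Nat.succ_ne_zero _)
  have hw : ∀ k : Fin (n + 1), seriesWeight a (e k) = N ^ (n - k.val) := by
    intro k
    induction k using Fin.lastCases with
    | last => simp [e, seriesWeight]
    | cast i => simp [e, seriesWeight, a]
  have hsum : ∀ d' : Option (Fin n) →₀ ℕ, ∑ s, seriesWeight a s * d' s =
      ∑ k : Fin (n + 1), N ^ (n + 1 - 1 - k.val) * d' (e k) := by
    intro d'
    rw [← Equiv.sum_comp e]
    simp only [hw, Nat.add_sub_cancel]
  have hval := congrArg (PowerSeries.coeff (∑ s, seriesWeight a s * d s)) (h a ha)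
  rw [coeff_evalSeries, map_zero, Finset.sum_eq_single d] at hval
  · exact hd hval
  · intro d' hd' hne
    simp only [Set.Finite.mem_toFinset, Set.mem_ofPred_eq] at hd'
    by_contra hc
    have h1 : ¬ key d' < key d := hmin d' hc
    rcases (not_lt.1 h1).eq_or_lt with h2 | h2
    · apply hne
      ext s
      have h3 := congrFun (toLex.injective h2) (e.symm s)
      simpa using h3.symm
    · obtain ⟨i, hi1, hi2⟩ := h2
      have h3 := sum_mul_pow_lt_of_lex (u := fun k => d (e k)) (v := fun k => d' (e k)) (N := N)
        (Nat.lt_succ_self _) i hi1 hi2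
      rw [hsum, hsum] at hd'
      omega
  · intro hd'
    simp at hd'

/-! ### Pochhammer symbols of length `a_i` as values of power series -/

section Poch

variable {A : Type*} [CommRing A]

theorem qPoch_add (q y : A) (k l : ℕ) :
    qPoch q y (k + l) = qPoch q y k * qPoch q (q ^ k * y) l := by
  rw [qPoch, Finset.prod_range_add, qPoch, qPoch]
  congr 1
  refine Finset.prod_congr rfl fun t _ => ?_
  ring

theorem dvd_qPoch_sub_one (q y c : A) (k : ℕ) (h : c ∣ y) : c ∣ qPoch q y k - 1 := by
  induction k with
  | zero => simp [qPoch]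
  | succ k ih =>
    have h1 : qPoch q y (k + 1) - 1 = (qPoch q y k - 1) - qPoch q y k * q ^ k * y := by
      rw [qPoch, Finset.prod_range_succ, ← qPoch]; ring
    rw [h1]
    exact dvd_sub ih (h.mul_left _)

theorem exists_inverse (y : MvPowerSeries (Option (Fin n)) A) (i : Fin n) (t : ℕ) :
    ∃ u, u * (1 - MvPowerSeries.X none ^ t * (MvPowerSeries.X (some i) * y)) = 1 := by
  have h : IsUnit (1 - MvPowerSeries.X none ^ t * (MvPowerSeries.X (some i) * y)) := by
    rw [MvPowerSeries.isUnit_iff_constantCoeff]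
    simp
  obtain ⟨u, hu⟩ := h.exists_left_inv
  exact ⟨u, hu⟩

theorem powerSeries_eq_of_X_pow_dvd (f g : PowerSeries A)
    (h : ∀ B : ℕ, (PowerSeries.X : PowerSeries A) ^ B ∣ f - g) : f = g := by
  ext k
  have := PowerSeries.X_pow_dvd_iff.1 (h (k + 1)) k (Nat.lt_succ_self k)
  rwa [map_sub, sub_eq_zero] at this

/-- `E` is `(y)_∞ / (z_i y)_∞`, built as the `q`-adic limit of the finite quotients `F B`. Each `1 -
q^t z_i y` is invertible because of its factor `z_i`, whatever the constant term of `y`. -/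
theorem exists_evalSeries_eq_qPoch (y : MvPowerSeries (Option (Fin n)) A) (i : Fin n) :
    ∃ E : MvPowerSeries (Option (Fin n)) A, ∀ (a : Fin n → ℕ) (ha : ∀ i, a i ≠ 0),
      evalSeries A (seriesWeight a) (seriesWeight_ne_zero ha) E =
        qPoch PowerSeries.X (evalSeries A (seriesWeight a) (seriesWeight_ne_zero ha) y) (a i) := by
  choose u hu using exists_inverse y i
  let Q : MvPowerSeries (Option (Fin n)) A := MvPowerSeries.X none
  let z : MvPowerSeries (Option (Fin n)) A := MvPowerSeries.X (some i)
  let F : ℕ → MvPowerSeries (Option (Fin n)) A := fun B =>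
    ∏ t ∈ Finset.range B, ((1 - Q ^ t * y) * u t)
  have hstep : ∀ B, Q ^ B ∣ F (B + 1) - F B := by
    intro B
    have h1 : F (B + 1) - F B = Q ^ B * (F B * u B * (y * (z - 1))) := by
      have h2 := hu B
      simp only [F, Finset.prod_range_succ]
      linear_combination (∏ t ∈ Finset.range B, ((1 - Q ^ t * y) * u t)) * h2
    exact ⟨_, h1⟩
  have hle : ∀ B C, B ≤ C → Q ^ B ∣ F C - F B := by
    intro B C hBC
    induction C, hBC using Nat.le_induction with
    | base => simp
    | succ C hC ih =>
      have h1 : F (C + 1) - F B = (F (C + 1) - F C) + (F C - F B) := by ring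
      rw [h1]
      exact dvd_add ((pow_dvd_pow _ hC).trans (hstep C)) ih
  -- A coefficient with `q`-exponent `d none` is unchanged from stage `d none + 1` onwards.
  let E : MvPowerSeries (Option (Fin n)) A := fun d => MvPowerSeries.coeff d (F (d none + 1))
  have hcoeff : ∀ d, MvPowerSeries.coeff d E = MvPowerSeries.coeff d (F (d none + 1)) :=
    fun d => rfl
  have hE : ∀ B, Q ^ B ∣ E - F B := by
    intro B
    rw [MvPowerSeries.X_pow_dvd_iff]
    intro d hd
    have h1 := MvPowerSeries.X_pow_dvd_iff.1 (hle (d none + 1) B hd) d (Nat.lt_succ_self _)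
    rw [map_sub, hcoeff, ← neg_sub, ← map_sub, h1, neg_zero]
  refine ⟨E, fun a ha => ?_⟩
  set ev := evalSeries A (seriesWeight a) (seriesWeight_ne_zero ha) with hev
  set Y := ev y with hY
  have hQ : ev Q = PowerSeries.X := by
    rw [hev, evalSeries_X]; simp [seriesWeight]
  have hz : ev z = PowerSeries.X ^ a i := by
    rw [hev, evalSeries_X]; simp [seriesWeight]
  apply powerSeries_eq_of_X_pow_dvd
  intro B
  have h1 : PowerSeries.X ^ B ∣ ev E - ev (F B) := by
    rw [← map_sub, ← hQ, ← map_pow]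
    exact map_dvd ev (hE B)
  have h2 : ∀ t, ev (u t) * (1 - PowerSeries.X ^ t * (PowerSeries.X ^ a i * Y)) = 1 := by
    intro t
    have h3 := congrArg ev (hu t)
    rw [map_mul, map_sub, map_one, map_mul, map_mul, map_pow] at h3
    change ev (u t) * (1 - ev Q ^ t * (ev z * Y)) = 1 at h3
    rwa [hQ, hz] at h3
  have h3 : ev (F B) = qPoch PowerSeries.X Y B * ∏ t ∈ Finset.range B, ev (u t) := by
    simp only [F, map_prod, map_mul, map_sub, map_one, map_pow, hQ, Finset.prod_mul_distrib]
    rfl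
  have h4 : (∏ t ∈ Finset.range B, ev (u t)) *
      qPoch PowerSeries.X (PowerSeries.X ^ a i * Y) B = 1 := by
    rw [qPoch, ← Finset.prod_mul_distrib]
    exact Finset.prod_eq_one fun t _ => h2 t
  have h5 : PowerSeries.X ^ B ∣ qPoch PowerSeries.X (PowerSeries.X ^ B * Y) (a i) - 1 :=
    dvd_qPoch_sub_one _ _ _ _ (Dvd.intro _ rfl)
  -- Splitting `(Y)_{a+B}` in two ways gives `(Y)_B / (X^a Y)_B = (Y)_a / (X^B Y)_a`, and the last
  -- denominator is `1` modulo `X^B`.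
  have h6 : ev (F B) - qPoch PowerSeries.X Y (a i) =
      -((∏ t ∈ Finset.range B, ev (u t)) * qPoch PowerSeries.X Y B *
        (qPoch PowerSeries.X (PowerSeries.X ^ B * Y) (a i) - 1)) := by
    have h7 := qPoch_add PowerSeries.X Y (a i) B
    rw [add_comm, qPoch_add PowerSeries.X Y B (a i)] at h7
    rw [h3]
    linear_combination (∏ t ∈ Finset.range B, ev (u t)) * h7 +
      (qPoch PowerSeries.X Y (a i)) * h4
  have h8 : ev E - qPoch PowerSeries.X Y (a i) =
      (ev E - ev (F B)) + (ev (F B) - qPoch PowerSeries.X Y (a i)) := by ring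
  rw [h8, h6]
  exact dvd_add h1 ((dvd_neg).2 (h5.mul_left _))

end Poch

/-! ### The `q`-Dyson product over `ℚ[q]` -/

/-- The Laurent monomial `x_i / x_j` over an arbitrary ring. -/
noncomputable def ratioOver (A : Type*) [CommRing A] (i j : Fin n) :
    AddMonoidAlgebra A (Fin n → ℤ) :=
  AddMonoidAlgebra.single (Pi.single i 1 - Pi.single j 1) 1

/-- The `q`-Dyson product over `ℚ[q]`. -/
noncomputable def qDysonPoly (a : Fin n → ℕ) : AddMonoidAlgebra (Polynomial ℚ) (Fin n → ℤ) :=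
  qDysonProd (AddMonoidAlgebra.single 0 Polynomial.X) (ratioOver _) a

theorem coeff_qDyson_eq_algebraMap (a : Fin n → ℕ) (δ : Fin n → ℤ) :
    (qDyson a).coeff δ = algebraMap (Polynomial ℚ) K ((qDysonPoly a).coeff δ) := by
  have h := map_qDysonProd (AddMonoidAlgebra.mapRingHom (Fin n → ℤ) (algebraMap (Polynomial ℚ) K))
    (AddMonoidAlgebra.single 0 Polynomial.X) (ratioOver _) a
  simp only [ratioOver, AddMonoidAlgebra.mapRingHom_single, RatFunc.algebraMap_X, map_one] at h
  change _ = qDyson a at h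
  rw [← h, AddMonoidAlgebra.coeff_mapRingHom]
  rfl

/-- The inclusion of `ℚ[q][x^±]` in `ℚ[x^±]⟦q⟧`. -/
noncomputable def toSeries (n : ℕ) : AddMonoidAlgebra (Polynomial ℚ) (Fin n → ℤ) →+*
    PowerSeries (AddMonoidAlgebra ℚ (Fin n → ℤ)) :=
  AddMonoidAlgebra.liftNCRingHom
    ((PowerSeries.map (algebraMap ℚ (AddMonoidAlgebra ℚ (Fin n → ℤ)))).comp
      Polynomial.coeToPowerSeries.ringHom)
    ((PowerSeries.C (R := AddMonoidAlgebra ℚ (Fin n → ℤ)) : _ →* _).comp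
      (AddMonoidAlgebra.of ℚ (Fin n → ℤ)))
    fun _ _ => Commute.all _ _

theorem toSeries_single (e : Fin n → ℤ) (p : Polynomial ℚ) :
    toSeries n (AddMonoidAlgebra.single e p) =
      PowerSeries.map (algebraMap ℚ (AddMonoidAlgebra ℚ (Fin n → ℤ))) (p : PowerSeries ℚ) *
        PowerSeries.C (AddMonoidAlgebra.single e 1) :=
  AddMonoidAlgebra.liftNC_single _ _ _ _

theorem coeff_coeff_toSeries (f : AddMonoidAlgebra (Polynomial ℚ) (Fin n → ℤ)) (δ : Fin n → ℤ)
    (k : ℕ) : (PowerSeries.coeff k (toSeries n f)).coeff δ = (f.coeff δ).coeff k := by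
  induction f using AddMonoidAlgebra.induction_linear with
  | zero => simp
  | add f g hf hg => simp [hf, hg]
  | single e p =>
    rw [toSeries_single, PowerSeries.coeff_mul_C, PowerSeries.coeff_map, Polynomial.coeff_coe,
      ← Algebra.smul_def, AddMonoidAlgebra.smul_single, AddMonoidAlgebra.coeff_single,
      AddMonoidAlgebra.coeff_single, Finsupp.single_apply, Finsupp.single_apply]
    split_ifs <;> simp

theorem toSeries_qDysonPoly (a : Fin n → ℕ) :
    toSeries n (qDysonPoly a) =
      qDysonProd PowerSeries.X (fun i j => PowerSeries.C (ratioOver ℚ i j)) a := by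
  rw [qDysonPoly, map_qDysonProd]
  congr 1
  · rw [toSeries_single, ← AddMonoidAlgebra.one_def]
    simp
  · funext i j
    rw [ratioOver, toSeries_single]
    simp [ratioOver]

/-- A power series in `q, z_1, …, z_n` whose values at `z_i = q^{a_i}` are the `q`-Dyson
products. -/
theorem exists_evalSeries_eq_qDyson (n : ℕ) :
    ∃ E : MvPowerSeries (Option (Fin n)) (AddMonoidAlgebra ℚ (Fin n → ℤ)),
      ∀ (a : Fin n → ℕ) (ha : ∀ i, a i ≠ 0),
        evalSeries _ (seriesWeight a) (seriesWeight_ne_zero ha) E = toSeries n (qDysonPoly a) := by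
  choose E hE using fun i j : Fin n => exists_evalSeries_eq_qPoch
    (MvPowerSeries.C (ratioOver ℚ i j)) i
  choose E' hE' using fun i j : Fin n => exists_evalSeries_eq_qPoch
    (MvPowerSeries.X none * MvPowerSeries.C (ratioOver ℚ j i)) j
  refine ⟨∏ i, ∏ j ∈ Finset.Ioi i, E i j * E' i j, fun a ha => ?_⟩
  rw [toSeries_qDysonPoly, qDysonProd]
  rw [map_prod]
  refine Finset.prod_congr rfl fun i _ => ?_
  rw [map_prod]
  refine Finset.prod_congr rfl fun j _ => ?_
  rw [map_mul, hE i j a ha, hE' i j a ha, map_mul, evalSeries_C, evalSeries_C, evalSeries_X]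
  simp [seriesWeight]

/-- Taking the coefficient of `x^δ` commutes with the evaluation, since every coefficient of an
evaluated series is a finite sum of coefficients. -/
theorem exists_evalSeries_eq_coeff (δ : Fin n → ℤ) :
    ∃ Z : MvPowerSeries (Option (Fin n)) ℚ, ∀ (a : Fin n → ℕ) (ha : ∀ i, a i ≠ 0),
      evalSeries ℚ (seriesWeight a) (seriesWeight_ne_zero ha) Z =
        (((qDysonPoly a).coeff δ : Polynomial ℚ) : PowerSeries ℚ) := by
  obtain ⟨E, hE⟩ := exists_evalSeries_eq_qDyson n
  let Z : MvPowerSeries (Option (Fin n)) ℚ := fun d => (MvPowerSeries.coeff d E).coeff δ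
  refine ⟨Z, fun a ha => ?_⟩
  ext k
  rw [Polynomial.coeff_coe, ← coeff_coeff_toSeries, ← hE a ha, coeff_evalSeries, coeff_evalSeries,
    AddMonoidAlgebra.coeff_sum, Finsupp.finsetSum_apply]
  rfl

theorem algebraMap_qPoch (k : ℕ) :
    algebraMap (Polynomial ℚ) K (qPoch Polynomial.X Polynomial.X k) =
      qPoch RatFunc.X RatFunc.X k := by
  rw [map_qPoch, RatFunc.algebraMap_X]

theorem coeff_zero_qPoch (k : ℕ) :
    Polynomial.constantCoeff (qPoch (Polynomial.X : Polynomial ℚ) Polynomial.X k) = 1 := by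
  rw [map_qPoch]
  simp [qPoch]

/-- By the `q`-Dyson theorem the polynomial is a quotient of products of `(q)_k`, all with constant
term `1`. -/
theorem constantCoeff_qDysonPoly (a : Fin n → ℕ) :
    Polynomial.constantCoeff ((qDysonPoly a).coeff 0) = 1 := by
  have h1 : (qDysonPoly a).coeff 0 * ∏ i, qPoch (Polynomial.X : Polynomial ℚ) Polynomial.X (a i) =
      qPoch Polynomial.X Polynomial.X (∑ i, a i) := by
    apply RatFunc.algebraMap_injective ℚ
    rw [map_mul, map_prod, ← coeff_qDyson_eq_algebraMap, coeff_zero_qDyson, qMultinomial]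
    simp only [algebraMap_qPoch]
    exact div_mul_cancel₀ _ (Finset.prod_ne_zero_iff.2 fun i _ => qFact_ne_zero (a i))
  have h2 := congrArg Polynomial.constantCoeff h1
  rw [map_mul, map_prod] at h2
  simpa only [coeff_zero_qPoch, Finset.prod_const_one, mul_one] using h2

/-! ### Polynomiality of the numerator -/

/-- The substitution `z_i = q^{a_i}` with values in `ℚ[q]`. -/
noncomputable def evalPoly (a : Fin n → ℕ) : Poly n →ₐ[ℚ] Polynomial ℚ :=
  MvPolynomial.aeval fun o => Polynomial.X ^ seriesWeight a o

theorem algebraMap_evalPoly (a : Fin n → ℕ) (P : Poly n) :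
    algebraMap (Polynomial ℚ) K (evalPoly a P) = evalAt a P := by
  have h : (IsScalarTower.toAlgHom ℚ (Polynomial ℚ) K).comp (evalPoly a) = evalAt a := by
    apply MvPolynomial.algHom_ext
    rintro (_ | i) <;> simp [evalPoly, evalAt, seriesWeight]
  exact DFunLike.congr_fun h P

theorem coe_evalPoly (a : Fin n → ℕ) (ha : ∀ i, a i ≠ 0) (P : Poly n) :
    ((evalPoly a P : Polynomial ℚ) : PowerSeries ℚ) =
      evalSeries ℚ (seriesWeight a) (seriesWeight_ne_zero ha) (P : MvPowerSeries _ ℚ) := by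
  have h : (Polynomial.coeToPowerSeries.algHom (R := ℚ) ℚ).comp (evalPoly a) =
      MvPolynomial.aeval (fun s => (PowerSeries.X : PowerSeries ℚ) ^ seriesWeight a s) := by
    apply MvPolynomial.algHom_ext
    intro o
    simp [evalPoly, Polynomial.coeToPowerSeries.algHom_apply]
  rw [evalSeries_coe, ← h]
  simp [Polynomial.coeToPowerSeries.algHom_apply]

theorem monomial_dvd_of_evalAt (P Q : Poly n) (μ : Option (Fin n) →₀ ℕ) (δ : Fin n → ℤ)
    (h : ∀ a : Fin n → ℕ, evalAt a P * (qDyson a).coeff 0 =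
      (qDyson a).coeff δ * evalAt a (MvPolynomial.monomial μ 1 * Q)) :
    MvPolynomial.monomial μ 1 ∣ P := by
  obtain ⟨Z₀, hZ₀⟩ := exists_evalSeries_eq_coeff (0 : Fin n → ℤ)
  obtain ⟨Z, hZ⟩ := exists_evalSeries_eq_coeff δ
  have h1 : (P : MvPowerSeries (Option (Fin n)) ℚ) * Z₀ =
      Z * ((MvPolynomial.monomial μ 1 * Q : Poly n) : MvPowerSeries _ ℚ) := by
    rw [← sub_eq_zero]
    apply eq_zero_of_evalSeries_eq_zero
    intro a ha
    rw [map_sub, sub_eq_zero, map_mul, map_mul, hZ₀ a ha, hZ a ha, ← coe_evalPoly a ha, ← coe_evalPoly a ha,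
      ← Polynomial.coe_mul, ← Polynomial.coe_mul]
    congr 1
    apply RatFunc.algebraMap_injective ℚ
    rw [map_mul, map_mul, algebraMap_evalPoly, algebraMap_evalPoly, ← coeff_qDyson_eq_algebraMap,
      ← coeff_qDyson_eq_algebraMap, h a]
  -- Evaluation preserves the constant coefficient, so a single positive vector, `a = (1, …, 1)`,
  -- determines it.
  have h2 : IsUnit Z₀ := by
    rw [MvPowerSeries.isUnit_iff_constantCoeff]
    have h3 := constantCoeff_evalSeries (seriesWeight (fun _ : Fin n => 1))
      (seriesWeight_ne_zero fun _ => one_ne_zero) Z₀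
    rw [hZ₀ _ fun _ => one_ne_zero, Polynomial.constantCoeff_coe] at h3
    rw [← h3]
    have h4 := constantCoeff_qDysonPoly (fun _ : Fin n => 1)
    rw [Polynomial.constantCoeff_apply] at h4
    rw [h4]
    exact isUnit_one
  obtain ⟨U, hU⟩ := h2.exists_right_inv
  have h3 : (P : MvPowerSeries (Option (Fin n)) ℚ) =
      MvPowerSeries.monomial μ 1 * ((Q : MvPowerSeries _ ℚ) * Z * U) := by
    rw [MvPolynomial.coe_mul, MvPolynomial.coe_monomial] at h1
    calc (P : MvPowerSeries (Option (Fin n)) ℚ) = P * Z₀ * U := by rw [mul_assoc, hU, mul_one]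
      _ = _ := by rw [h1]; ring
  -- Divisibility by a monomial is a condition on the support, so it passes from power series to
  -- polynomials.
  rw [MvPolynomial.monomial_one_dvd_iff_modMonomial_eq_zero]
  ext d
  by_cases hd : μ ≤ d
  · rw [MvPolynomial.coeff_modMonomial_of_le _ hd, MvPolynomial.coeff_zero]
  · rw [MvPolynomial.coeff_modMonomial_of_not_le _ hd, MvPolynomial.coeff_zero,
      ← MvPolynomial.coeff_coe, h3, MvPowerSeries.coeff_monomial_mul, if_neg hd]

theorem exists_numerator (δ : Fin n → ℤ) (hδ : ∑ i, δ i = 0) :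
    ∃ (N : Poly n) (Ls : Multiset (AffineForm n)), (∀ L ∈ Ls, 1 ≤ L.const) ∧
      R δ = algebraMap (Poly n) (Rat n) N /
        algebraMap (Poly n) (Rat n) (Ls.map oneSubQPow).prod ∧
      ∀ a : Fin n → ℕ, evalAt a (Ls.map oneSubQPow).prod ≠ 0 ∧
        (qDyson a).coeff δ =
          evalAt a N / evalAt a (Ls.map oneSubQPow).prod * qMultinomial a := by
  obtain ⟨P, D, hD, h1, h2⟩ := HasValue.R δ
  have hne := algebraMap_ne_zero_of_mem hD
  have hDa := fun a => evalAt_ne_zero_of_mem a hD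
  obtain ⟨μ, Ls, hLs, rfl⟩ := hD
  -- The monomial comes from negative powers of `q` and `z_i` in the summands; it divides the
  -- numerator of their sum and can be cancelled.
  obtain ⟨N, rfl⟩ : MvPolynomial.monomial μ 1 ∣ P := by
    apply monomial_dvd_of_evalAt P (Ls.map oneSubQPow).prod μ δ
    intro a
    rw [coeff_zero_qDyson, coeff_qDyson_eq_sum_summandAt a hδ, ← h2 a]
    ring
  refine ⟨N, Ls, hLs, ?_, fun a => ⟨evalAt_prod_oneSubQPow_ne_zero a Ls hLs, ?_⟩⟩
  · rw [map_mul] at hne h1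
    rw [map_mul, mul_left_comm] at h1
    rw [eq_div_iff (right_ne_zero_of_mul hne)]
    exact mul_left_cancel₀ (left_ne_zero_of_mul hne) h1
  · have h3 := h2 a
    have h4 := hDa a
    rw [map_mul] at h4
    rw [map_mul, map_mul, mul_left_comm] at h3
    rw [coeff_qDyson_eq_sum_summandAt a hδ]
    congr 1
    rw [eq_div_iff (right_ne_zero_of_mul h4)]
    exact mul_left_cancel₀ (left_ne_zero_of_mul h4) h3

end QDyson

theorem fact6 (n : ℕ) (δ : Fin n → ℤ) (hδ : ∑ i, δ i = 0) :
    (∃ (N : QDyson.Poly n) (Ls : Multiset (QDyson.AffineForm n)),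
      (∀ L ∈ Ls, 1 ≤ L.const) ∧
      QDyson.R δ = algebraMap (QDyson.Poly n) (QDyson.Rat n) N /
        algebraMap (QDyson.Poly n) (QDyson.Rat n) (Ls.map QDyson.oneSubQPow).prod ∧
      ∀ a : Fin n → ℕ,
        QDyson.evalAt a (Ls.map QDyson.oneSubQPow).prod ≠ 0 ∧
        (QDyson.qDyson a).coeff δ =
          QDyson.evalAt a N / QDyson.evalAt a (Ls.map QDyson.oneSubQPow).prod *
            QDyson.qMultinomial a) ∧
    (∀ a : Fin n → ℕ,
      Set.InjOn (QDyson.latticePoint a) {p | QDyson.Feasible δ p.1 p.2} ∧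
      (∀ α : Fin n → ℤ, QDyson.InGrid δ a α →
        (QDyson.qDysonAt a α ≠ 0 ↔
          ∃ p : Equiv.Perm (Fin n) × (Fin n → ℕ),
            QDyson.Feasible δ p.1 p.2 ∧ QDyson.latticePoint a p = α)) ∧
      ((∀ i, ∑ j, |δ j| ≤ (a i : ℤ)) →
        ∀ p : Equiv.Perm (Fin n) × (Fin n → ℕ), QDyson.Feasible δ p.1 p.2 →
          QDyson.InGrid δ a (QDyson.latticePoint a p))) :=
  ⟨QDyson.exists_numerator δ hδ, fun a =>
    ⟨(QDyson.latticePoint_injective a).injOn, QDyson.qDysonAt_ne_zero_iff_exists δ a,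
      QDyson.inGrid_latticePoint δ a⟩⟩
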